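/- Let $M^{2n+1}$ be a smooth manifold with a Riemannian metric $g$, Levi-Civita connection $\nabla$, curvature tensor $K(X,Y)=[\nabla_X,\nabla_Y]-\nabla_{[X,Y]}$, Ricci tensor $\mathrm{Ric}(Y,Z)=\operatorname{tr}(X\mapsto K(X,Y)Z)$ and scalar curvature $\tau=\operatorname{tr}_g\mathrm{Ric}$. Let $(\varphi,\zeta,\eta,g)$ be an almost co-Kähler structure on $M$: $\varphi$ is a smooth $(1,1)$-tensor field, $\zeta$ a smooth vector field and $\eta$ a smooth $1$-form with $$\varphi^2+I=\eta\otimes\zeta,\qquad \eta(\zeta)=1,\qquad g(X,Y)=g(\varphi X,\varphi Y)+\eta(X)\eta(Y),$$ and $d\eta=0$, $d\Phi=0$, where $\Phi(X,Y)=g(X,\varphi Y)$. Put $h=\tfrac12\pounds_\zeta\varphi$. Suppose that $\mathrm{Ric}=a_1\,g+b_1\,\eta\otimes\eta$ with real constants $a_1$, $b_1$ and $b_1\neq0$. Suppose also that $g$ is $(m,\rho)$-quasi-Einstein with $0<m\le\infty$, $m\neq1$ and $\rho\in\mathbb R$; that is, there are a smooth function $\omega:M\to\mathbb R$ and a constant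 $\lambda_1\in\mathbb R$ with $$\mathrm{Ric}+\mathrm{Hess}\,\omega-\frac1m\,d\omega\otimes d\omega=(\rho\tau+\lambda_1)\,g,$$ where $\frac1m=0$ if $m=\infty$. Suppose finally that $a_1\neq\frac1m(2n-1)b_1$; that is, $ma_1\neq(2n-1)b_1$ if $m<\infty$, and $a_1\neq0$ if $m=\infty$. Then $h=0$ and $\zeta$ is a Killing vector field ($\pounds_\zeta g=0$); that is, $M$ is a $K$-almost co-Kähler manifold. -/

import Mathlib

open Bundle VectorField
open scoped Manifold ContDiff ENNReal

noncomputable section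

namespace Riem

/-! ### Riemannian geometry on a finite-dimensional manifold

The Riemannian metric is the one carried by the tangent bundle, `g(u, v) = inner ℝ u v`. -/

section Geometry

variable {E : Type*} [NormedAddCommGroup E] [NormedSpace ℝ E] [FiniteDimensional ℝ E]
  {H : Type*} [TopologicalSpace H] (I : ModelWithCorners ℝ E H)
  {M : Type*} [TopologicalSpace M] [ChartedSpace H M] [IsManifold I ∞ M]
  [RiemannianBundle (fun x : M ↦ TangentSpace I x)]

instance tangentSpace_finiteDimensional (x : M) : FiniteDimensional ℝ (TangentSpace I x) :=
  inferInstanceAs (FiniteDimensional ℝ E)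

/-- The vector field `X` is smooth at (hence in a neighbourhood of) the point `x`. -/
def SmoothFieldAt (X : Π x : M, TangentSpace I x) (x : M) : Prop :=
  ContMDiffAt I (I.prod 𝓘(ℝ, E)) ∞ (fun y ↦ TotalSpace.mk' E y (X y)) x

/-- An orthonormal basis of the tangent space at `x`. -/
def frame (x : M) :
    OrthonormalBasis (Fin (Module.finrank ℝ (TangentSpace I x))) ℝ (TangentSpace I x) :=
  stdOrthonormalBasis ℝ (TangentSpace I x)

/-- The metric dual of a linear form `α` on `T_x M`: the vector `∑ᵢ α(eᵢ) eᵢ`, which for linear `α`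
is the only vector with `g(sharp α, v) = α(v)` for all `v`. -/
def sharp (x : M) (α : TangentSpace I x → ℝ) : TangentSpace I x :=
  ∑ i, α (frame I x i) • frame I x i

/-- A vector field, smooth near `x`, whose value at `x` is the tangent vector `v`. -/
def ext {x : M} (v : TangentSpace I x) : Π y : M, TangentSpace I y :=
  FiberBundle.extend E v

/-- The right-hand side of Koszul's formula for `2 g(∇_X Y, Z)`. -/
def koszul (X Y Z : Π x : M, TangentSpace I x) (x : M) : ℝ :=
  mvfderiv I (fun y ↦ (inner ℝ (Y y) (Z y) : ℝ)) x (X x)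
    + mvfderiv I (fun y ↦ (inner ℝ (Z y) (X y) : ℝ)) x (Y x)
    - mvfderiv I (fun y ↦ (inner ℝ (X y) (Y y) : ℝ)) x (Z x)
    + inner ℝ (mlieBracket I X Y x) (Z x)
    - inner ℝ (mlieBracket I Y Z x) (X x)
    + inner ℝ (mlieBracket I Z X x) (Y x)

/-- The Levi-Civita (Riemannian) connection `∇_X Y`, given by Koszul's formula. -/
def nabla (X Y : Π x : M, TangentSpace I x) (x : M) : TangentSpace I x :=
  sharp I x fun z ↦ koszul I X Y (ext I z) x / 2

/-- The curvature tensor `K(X, Y)Z = ∇_X ∇_Y Z - ∇_Y ∇_X Z - ∇_{[X, Y]} Z`. -/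
def curvature (X Y Z : Π x : M, TangentSpace I x) (x : M) : TangentSpace I x :=
  nabla I X (nabla I Y Z) x - nabla I Y (nabla I X Z) x - nabla I (mlieBracket I X Y) Z x

/-- The Ricci tensor `Ric(u, v)`: the trace of `w ↦ K(w, u)v` on `T_x M`. -/
def ricci (x : M) (u v : TangentSpace I x) : ℝ :=
  ∑ i, inner ℝ (curvature I (ext I (frame I x i)) (ext I u) (ext I v) x) (frame I x i)

/-- The scalar curvature `τ`: the trace of the Ricci tensor. -/
def scalarCurvature (x : M) : ℝ :=
  ∑ i, ricci I x (frame I x i) (frame I x i)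

/-- The gradient `Df` of a function `f`. -/
def grad (f : M → ℝ) (x : M) : TangentSpace I x :=
  sharp I x fun z ↦ mvfderiv I f x z

/-- The Hessian `Hess f (u, v) = g(∇_u Df, v)`. -/
def hess (f : M → ℝ) (x : M) (u v : TangentSpace I x) : ℝ :=
  inner ℝ (nabla I (ext I u) (grad I f) x) v

variable (M) in
/-- The metric of `M` is an `(m, ρ)`-quasi-Einstein soliton, where `0 < m ≤ ∞` and `1 / ∞ = 0`:
there are a smooth function `f` and a constant `lam` with
`Ric + Hess f - (1/m) df ⊗ df = (ρ τ + lam) g`. -/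
def IsQuasiEinstein (m : ℝ≥0∞) (ρ : ℝ) : Prop :=
  0 < m ∧ ∃ (f : M → ℝ) (lam : ℝ), ContMDiff I 𝓘(ℝ, ℝ) ∞ f ∧
    ∀ (x : M) (u v : TangentSpace I x),
      ricci I x u v + hess I f x u v - (m⁻¹).toReal * (mvfderiv I f x u * mvfderiv I f x v)
        = (ρ * scalarCurvature I x + lam) * inner ℝ u v

/-- The Lie derivative of the metric:
`(£_V g)(X, Y) = V g(X, Y) - g([V, X], Y) - g(X, [V, Y])`. -/
def lieMetric (V X Y : Π x : M, TangentSpace I x) (x : M) : ℝ :=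
  mvfderiv I (fun y ↦ (inner ℝ (X y) (Y y) : ℝ)) x (V x)
    - inner ℝ (mlieBracket I V X x) (Y x) - inner ℝ (X x) (mlieBracket I V Y x)

/-- `V` is a Killing vector field: `£_V g = 0`. -/
def IsKilling (V : Π x : M, TangentSpace I x) : Prop :=
  ∀ (x : M) (X Y : Π x : M, TangentSpace I x), SmoothFieldAt I X x → SmoothFieldAt I Y x →
    lieMetric I V X Y x = 0

/-- The exterior derivative of a `1`-form, on vector fields. -/
def extDeriv₁ (α : Π x : M, TangentSpace I x → ℝ) (X Y : Π x : M, TangentSpace I x) (x : M) : ℝ :=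
  mvfderiv I (fun y ↦ α y (Y y)) x (X x) - mvfderiv I (fun y ↦ α y (X y)) x (Y x)
    - α x (mlieBracket I X Y x)

/-- The exterior derivative of a `2`-form, on vector fields. -/
def extDeriv₂ (B : Π x : M, TangentSpace I x → TangentSpace I x → ℝ)
    (X Y Z : Π x : M, TangentSpace I x) (x : M) : ℝ :=
  mvfderiv I (fun y ↦ B y (Y y) (Z y)) x (X x)
    + mvfderiv I (fun y ↦ B y (Z y) (X y)) x (Y x)
    + mvfderiv I (fun y ↦ B y (X y) (Y y)) x (Z x)
    - B x (mlieBracket I X Y x) (Z x)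
    - B x (mlieBracket I Y Z x) (X x)
    - B x (mlieBracket I Z X x) (Y x)

variable (M) in
/-- An almost contact metric structure `(φ, ζ, η)` compatible with the metric of `M`: smooth tensor
fields with `φ² + id = η ⊗ ζ`, `η(ζ) = 1` and `g(u, v) = g(φ u, φ v) + η(u) η(v)`. -/
structure AlmostContactMetric where
  /-- the `(1,1)`-tensor field -/
  φ : Π x : M, TangentSpace I x →L[ℝ] TangentSpace I x
  /-- the characteristic vector field -/
  ζ : Π x : M, TangentSpace I x
  /-- the `1`-form -/
  η : Π x : M, TangentSpace I x →L[ℝ] ℝ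
  smooth_φ : ContMDiff I (I.prod 𝓘(ℝ, E →L[ℝ] E)) ∞
    (fun x ↦ TotalSpace.mk' (E →L[ℝ] E) x (φ x))
  smooth_ζ : ∀ x, SmoothFieldAt I ζ x
  smooth_η : ContMDiff I (I.prod 𝓘(ℝ, E →L[ℝ] ℝ)) ∞
    (fun x ↦ TotalSpace.mk' (E →L[ℝ] ℝ) x (η x))
  φ_sq : ∀ (x : M) (u : TangentSpace I x), φ x (φ x u) + u = η x u • ζ x
  η_ζ : ∀ x : M, η x (ζ x) = 1
  compat : ∀ (x : M) (u v : TangentSpace I x),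
    (inner ℝ u v : ℝ) = inner ℝ (φ x u) (φ x v) + η x u * η x v

namespace AlmostContactMetric

variable {I} (S : AlmostContactMetric I M)

/-- The fundamental `2`-form `Φ(u, v) = g(u, φ v)`. -/
def fundamentalForm (x : M) (u v : TangentSpace I x) : ℝ :=
  inner ℝ u (S.φ x v)

/-- The structure is almost co-Kähler: `dη = 0` and `dΦ = 0`. -/
def IsAlmostCoKahler : Prop :=
  (∀ (x : M) (X Y : Π x : M, TangentSpace I x), SmoothFieldAt I X x → SmoothFieldAt I Y x →
    extDeriv₁ I (fun y u ↦ S.η y u) X Y x = 0) ∧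
  (∀ (x : M) (X Y Z : Π x : M, TangentSpace I x), SmoothFieldAt I X x → SmoothFieldAt I Y x →
    SmoothFieldAt I Z x → extDeriv₂ I S.fundamentalForm X Y Z x = 0)

/-- The structure is `K`-almost co-Kähler: almost co-Kähler with `ζ` Killing. -/
def IsKAlmostCoKahler : Prop :=
  S.IsAlmostCoKahler ∧ IsKilling I S.ζ

/-- The tensor field `h = (1/2) £_ζ φ`, where `(£_ζ φ)X = [ζ, φ X] - φ [ζ, X]`. -/
def h (x : M) (u : TangentSpace I x) : TangentSpace I x :=
  (1 / 2 : ℝ) • (mlieBracket I S.ζ (fun y ↦ S.φ y (ext I u y)) x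
    - S.φ x (mlieBracket I S.ζ (ext I u) x))

/-- The `η`-Einstein condition with constant coefficients: `Ric = a g + b η ⊗ η`. -/
def IsEtaEinstein (a b : ℝ) : Prop :=
  ∀ (x : M) (u v : TangentSpace I x),
    ricci I x u v = a * inner ℝ u v + b * (S.η x u * S.η x v)

end AlmostContactMetric

end Geometry

end Riem

end

open scoped Topology

set_option linter.unusedSectionVars false

namespace Riem

section LeviCivita

variable {E : Type*} [NormedAddCommGroup E] [NormedSpace ℝ E] [FiniteDimensional ℝ E]
  {H : Type*} [TopologicalSpace H] {I : ModelWithCorners ℝ E H}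
  {M : Type*} [TopologicalSpace M] [ChartedSpace H M] [IsManifold I ∞ M]
  [RiemannianBundle (fun x : M ↦ TangentSpace I x)]
  [IsContMDiffRiemannianBundle I ∞ E (fun x : M ↦ TangentSpace I x)]

theorem sharp_inner (x : M) (α : TangentSpace I x →ₗ[ℝ] ℝ) (v : TangentSpace I x) :
    inner ℝ (sharp I x α) v = α v := by
  have h := (frame I x).sum_repr v
  conv_rhs => rw [← h]
  simp only [sharp, sum_inner, inner_smul_left, map_sum, map_smul, smul_eq_mul]
  refine Finset.sum_congr rfl fun i _ ↦ ?_
  rw [(frame I x).repr_apply_apply]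
  simp [mul_comm]

theorem mdifferentiableAt_inner {X Y : Π x : M, TangentSpace I x} {x : M}
    (hX : MDiffAt (T% X) x) (hY : MDiffAt (T% Y) x) :
    MDiffAt (fun y ↦ (inner ℝ (X y) (Y y) : ℝ)) x :=
  MDifferentiableAt.inner_bundle (E := fun x : M ↦ TangentSpace I x) (F := E) (IB := I)
    (b := fun y ↦ y) hX hY

theorem koszul_smul_right {X Y Z : Π x : M, TangentSpace I x} {f : M → ℝ} {x : M}
    (hX : MDiffAt (T% X) x) (hY : MDiffAt (T% Y) x) (hZ : MDiffAt (T% Z) x) (hf : MDiffAt f x) :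
    koszul I X Y (f • Z) x = f x * koszul I X Y Z x := by
  have h1 := mdifferentiableAt_inner hY hZ
  have h2 := mdifferentiableAt_inner hZ hX
  simp only [koszul, Pi.smul_apply', inner_smul_left, inner_smul_right, conj_trivial]
  rw [mlieBracket_smul_right hf hZ, mlieBracket_smul_left hf hZ]
  rw [mvfderiv_fun_mul hf h1]
  rw [mvfderiv_fun_mul hf h2]
  simp [inner_add_left, inner_smul_left, real_inner_comm]
  ring

theorem koszul_add_right {X Y Z W : Π x : M, TangentSpace I x} {x : M}
    (hX : MDiffAt (T% X) x) (hY : MDiffAt (T% Y) x) (hZ : MDiffAt (T% Z) x)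
    (hW : MDiffAt (T% W) x) :
    koszul I X Y (Z + W) x = koszul I X Y Z x + koszul I X Y W x := by
  simp only [koszul, Pi.add_apply, inner_add_left, inner_add_right]
  rw [mlieBracket_add_right hZ hW, mlieBracket_add_left hZ hW,
    mvfderiv_fun_add (mdifferentiableAt_inner hY hZ) (mdifferentiableAt_inner hY hW),
    mvfderiv_fun_add (mdifferentiableAt_inner hZ hX) (mdifferentiableAt_inner hW hX)]
  simp [inner_add_left]
  ring

theorem ext_self {x : M} (v : TangentSpace I x) : ext I v x = v := by simp [ext]

theorem mdifferentiableAt_ext {x : M} (v : TangentSpace I x) : MDiffAt (T% (ext I v)) x :=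
  FiberBundle.mdifferentiableAt_extend I E v

theorem koszul_tensorialAt {X Y : Π x : M, TangentSpace I x} {x : M}
    (hX : MDiffAt (T% X) x) (hY : MDiffAt (T% Y) x) :
    TensorialAt I E (fun Z : Π x : M, TangentSpace I x ↦ koszul I X Y Z x) x where
  smul hf hZ := koszul_smul_right hX hY hZ hf
  add hZ hW := koszul_add_right hX hY hZ hW

/-- Koszul's formula: `2 g(∇_X Y, Z)` is given by `koszul X Y Z`. -/
theorem inner_nabla {X Y Z : Π x : M, TangentSpace I x} {x : M}
    (hX : MDiffAt (T% X) x) (hY : MDiffAt (T% Y) x) (hZ : MDiffAt (T% Z) x) :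
    inner ℝ (nabla I X Y x) (Z x) = koszul I X Y Z x / 2 := by
  have hT := koszul_tensorialAt hX hY
  set α := TensorialAt.mkHom (fun Z : Π x : M, TangentSpace I x ↦ koszul I X Y Z x) x hT
  have h1 := sharp_inner x ((1 / 2 : ℝ) • α.toLinearMap) (Z x)
  have h2 : α (Z x) = koszul I X Y Z x := TensorialAt.mkHom_apply hT hZ
  have h3 : ∀ z, α z = koszul I X Y (ext I z) x := fun z ↦ rfl
  simp only [LinearMap.smul_apply, ContinuousLinearMap.coe_coe, h2, smul_eq_mul] at h1
  rw [div_eq_inv_mul, ← one_div, ← h1]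
  congr 1
  unfold nabla
  congr 1
  funext z
  simp only [LinearMap.smul_apply, ContinuousLinearMap.coe_coe, h3, smul_eq_mul]
  ring

theorem inner_nabla_ext {X Y : Π x : M, TangentSpace I x} {x : M}
    (hX : MDiffAt (T% X) x) (hY : MDiffAt (T% Y) x) (v : TangentSpace I x) :
    inner ℝ (nabla I X Y x) v = koszul I X Y (ext I v) x / 2 := by
  rw [← inner_nabla hX hY (mdifferentiableAt_ext v), ext_self]

theorem mvfderiv_congr {f g : M → ℝ} {x : M} (h : f =ᶠ[𝓝 x] g) :
    mvfderiv I f x = mvfderiv I g x := by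
  have h1 := h.mfderiv_eq (I := I) (I' := 𝓘(ℝ, ℝ))
  ext v
  exact congrArg (fun L ↦ L v) h1

theorem mvfderiv_inner_comm (X Y : Π x : M, TangentSpace I x) (x : M) :
    mvfderiv I (fun y ↦ (inner ℝ (X y) (Y y) : ℝ)) x
      = mvfderiv I (fun y ↦ (inner ℝ (Y y) (X y) : ℝ)) x := by
  congr 1
  funext y
  exact real_inner_comm _ _

/-- The Levi-Civita connection is metric. -/
theorem mvfderiv_inner {X Y Z : Π x : M, TangentSpace I x} {x : M}
    (hX : MDiffAt (T% X) x) (hY : MDiffAt (T% Y) x) (hZ : MDiffAt (T% Z) x) :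
    mvfderiv I (fun y ↦ (inner ℝ (Y y) (Z y) : ℝ)) x (X x)
      = inner ℝ (nabla I X Y x) (Z x) + inner ℝ (Y x) (nabla I X Z x) := by
  rw [real_inner_comm (nabla I X Z x), inner_nabla hX hY hZ, inner_nabla hX hZ hY]
  simp only [koszul]
  rw [mvfderiv_inner_comm Z Y, mvfderiv_inner_comm X Z, mvfderiv_inner_comm Y X,
    mlieBracket_swap_apply (V := X) (W := Z), mlieBracket_swap_apply (V := Z) (W := Y),
    mlieBracket_swap_apply (V := Y) (W := X)]
  simp only [inner_neg_left]
  ring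

/-- The Levi-Civita connection is torsion-free. -/
theorem nabla_sub_nabla {X Y : Π x : M, TangentSpace I x} {x : M}
    (hX : MDiffAt (T% X) x) (hY : MDiffAt (T% Y) x) :
    nabla I X Y x - nabla I Y X x = mlieBracket I X Y x := by
  refine ext_inner_right ℝ fun w ↦ ?_
  have hW := mdifferentiableAt_ext w
  rw [inner_sub_left, inner_nabla_ext hX hY, inner_nabla_ext hY hX]
  simp only [koszul, ext_self]
  set W := ext I w
  rw [mvfderiv_inner_comm Y X, mvfderiv_inner_comm W Y, mvfderiv_inner_comm X W,
    mlieBracket_swap_apply (V := X) (W := W), mlieBracket_swap_apply (V := W) (W := Y),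
    mlieBracket_swap_apply (V := Y) (W := X)]
  simp only [inner_neg_left]
  ring

theorem nabla_smul_left {X Y : Π x : M, TangentSpace I x} {f : M → ℝ} {x : M}
    (hX : MDiffAt (T% X) x) (hY : MDiffAt (T% Y) x) (hf : MDiffAt f x) :
    nabla I (f • X) Y x = f x • nabla I X Y x := by
  refine ext_inner_right ℝ fun w ↦ ?_
  have hW := mdifferentiableAt_ext w
  rw [inner_smul_left, inner_nabla_ext (hf.smul_section hX) hY, inner_nabla_ext hX hY]
  set W := ext I w
  simp only [koszul, Pi.smul_apply', inner_smul_left, inner_smul_right, conj_trivial]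
  rw [mlieBracket_smul_right hf hX, mlieBracket_smul_left hf hX,
    mvfderiv_fun_mul hf (mdifferentiableAt_inner hX hY),
    mvfderiv_fun_mul hf (mdifferentiableAt_inner hW hX)]
  simp [inner_add_left, inner_smul_left, real_inner_comm]
  ring

theorem nabla_add_left {X X' Y : Π x : M, TangentSpace I x} {x : M}
    (hX : MDiffAt (T% X) x) (hX' : MDiffAt (T% X') x) (hY : MDiffAt (T% Y) x) :
    nabla I (X + X') Y x = nabla I X Y x + nabla I X' Y x := by
  refine ext_inner_right ℝ fun w ↦ ?_
  have hW := mdifferentiableAt_ext w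
  rw [inner_add_left, inner_nabla_ext (mdifferentiableAt_add_section hX hX') hY,
    inner_nabla_ext hX hY, inner_nabla_ext hX' hY]
  set W := ext I w
  simp only [koszul, Pi.add_apply, inner_add_left, inner_add_right]
  rw [mlieBracket_add_right hX hX', mlieBracket_add_left hX hX',
    mvfderiv_fun_add (mdifferentiableAt_inner hX hY) (mdifferentiableAt_inner hX' hY),
    mvfderiv_fun_add (mdifferentiableAt_inner hW hX) (mdifferentiableAt_inner hW hX')]
  simp [inner_add_left]
  ring

theorem nabla_smul_right {X Y : Π x : M, TangentSpace I x} {f : M → ℝ} {x : M}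
    (hX : MDiffAt (T% X) x) (hY : MDiffAt (T% Y) x) (hf : MDiffAt f x) :
    nabla I X (f • Y) x = mvfderiv I f x (X x) • Y x + f x • nabla I X Y x := by
  refine ext_inner_right ℝ fun w ↦ ?_
  obtain ⟨W, hW, rfl⟩ : ∃ W : Π x : M, TangentSpace I x, MDiffAt (T% W) x ∧ W x = w :=
    ⟨ext I w, mdifferentiableAt_ext w, ext_self w⟩
  rw [inner_add_left, inner_smul_left, inner_smul_left, inner_nabla hX (hf.smul_section hY) hW,
    inner_nabla hX hY hW]
  simp only [koszul, Pi.smul_apply', inner_smul_left, inner_smul_right, conj_trivial]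
  rw [mlieBracket_smul_right hf hY, mlieBracket_smul_left hf hY,
    mvfderiv_fun_mul hf (mdifferentiableAt_inner hY hW),
    mvfderiv_fun_mul hf (mdifferentiableAt_inner hX hY)]
  simp [inner_add_left, inner_smul_left, real_inner_comm]
  ring

theorem nabla_add_right {X Y Y' : Π x : M, TangentSpace I x} {x : M}
    (hX : MDiffAt (T% X) x) (hY : MDiffAt (T% Y) x) (hY' : MDiffAt (T% Y') x) :
    nabla I X (Y + Y') x = nabla I X Y x + nabla I X Y' x := by
  refine ext_inner_right ℝ fun w ↦ ?_
  have hW := mdifferentiableAt_ext w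
  rw [inner_add_left, inner_nabla_ext hX (mdifferentiableAt_add_section hY hY'),
    inner_nabla_ext hX hY, inner_nabla_ext hX hY']
  set W := ext I w
  simp only [koszul, Pi.add_apply, inner_add_left, inner_add_right]
  rw [mlieBracket_add_right hY hY', mlieBracket_add_left hY hY',
    mvfderiv_fun_add (mdifferentiableAt_inner hX hY) (mdifferentiableAt_inner hX hY'),
    mvfderiv_fun_add (mdifferentiableAt_inner hY hW) (mdifferentiableAt_inner hY' hW)]
  simp [inner_add_left]
  ring

theorem nabla_tensorialAt {Y : Π x : M, TangentSpace I x} {x : M} (hY : MDiffAt (T% Y) x) :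
    TensorialAt I E (fun X : Π x : M, TangentSpace I x ↦ nabla I X Y x) x where
  smul hf hX := nabla_smul_left hX hY hf
  add hX hX' := nabla_add_left hX hX' hY

/-- `∇_X Y` depends on `X` only through its value at the point. -/
theorem nabla_congr_left {X X' Y : Π x : M, TangentSpace I x} {x : M} (hX : MDiffAt (T% X) x)
    (hX' : MDiffAt (T% X') x) (hY : MDiffAt (T% Y) x) (h : X x = X' x) :
    nabla I X Y x = nabla I X' Y x :=
  (nabla_tensorialAt hY).pointwise hX hX' h

/-- `∇_X Y` depends only on the germ of `Y`. -/
theorem nabla_congr_right (X : Π x : M, TangentSpace I x) {Y Y' : Π x : M, TangentSpace I x}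
    {x : M} (h : ∀ᶠ y in 𝓝 x, Y y = Y' y) : nabla I X Y x = nabla I X Y' x := by
  have h' : Y =ᶠ[𝓝 x] Y' := h
  unfold nabla
  congr 1
  funext z
  simp only [koszul]
  have e1 : (fun y ↦ (inner ℝ (Y y) (ext I z y) : ℝ)) =ᶠ[𝓝 x]
      fun y ↦ (inner ℝ (Y' y) (ext I z y) : ℝ) := by
    filter_upwards [h] with y hy
    rw [hy]
  have e2 : (fun y ↦ (inner ℝ (X y) (Y y) : ℝ)) =ᶠ[𝓝 x]
      fun y ↦ (inner ℝ (X y) (Y' y) : ℝ) := by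
    filter_upwards [h] with y hy
    rw [hy]
  rw [mvfderiv_congr e1, mvfderiv_congr e2,
    (Filter.EventuallyEq.refl (𝓝 x) X).mlieBracket_vectorField_eq h',
    h'.mlieBracket_vectorField_eq (Filter.EventuallyEq.refl (𝓝 x) (ext I z)), h.self_of_nhds]

end LeviCivita

section Smooth

variable {E : Type*} [NormedAddCommGroup E] [NormedSpace ℝ E] [FiniteDimensional ℝ E]
  {H : Type*} [TopologicalSpace H] {I : ModelWithCorners ℝ E H}
  {M : Type*} [TopologicalSpace M] [ChartedSpace H M] [IsManifold I ∞ M]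
  [RiemannianBundle (fun x : M ↦ TangentSpace I x)]
  [IsContMDiffRiemannianBundle I ∞ E (fun x : M ↦ TangentSpace I x)]

/-- The vector field `X` is smooth at every point of a neighbourhood of `x`. -/
def SmoothFieldNear (X : Π x : M, TangentSpace I x) (x : M) : Prop :=
  ∀ᶠ y in 𝓝 x, SmoothFieldAt I X y

variable (I) in
/-- The function `f` is smooth at every point of a neighbourhood of `x`. -/
def SmoothFnNear (f : M → ℝ) (x : M) : Prop :=
  ∀ᶠ y in 𝓝 x, ContMDiffAt I 𝓘(ℝ, ℝ) ∞ f y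

theorem SmoothFieldAt.mdifferentiableAt {X : Π x : M, TangentSpace I x} {x : M}
    (hX : SmoothFieldAt I X x) : MDiffAt (T% X) x :=
  ContMDiffAt.mdifferentiableAt hX (by simp)

theorem SmoothFieldNear.at {X : Π x : M, TangentSpace I x} {x : M} (hX : SmoothFieldNear X x) :
    SmoothFieldAt I X x := hX.self_of_nhds

theorem SmoothFieldNear.mdifferentiableAt {X : Π x : M, TangentSpace I x} {x : M}
    (hX : SmoothFieldNear X x) : MDiffAt (T% X) x := hX.at.mdifferentiableAt

theorem SmoothFieldNear.eventually {X : Π x : M, TangentSpace I x} {x : M}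
    (hX : SmoothFieldNear X x) : ∀ᶠ y in 𝓝 x, SmoothFieldNear X y :=
  Filter.Eventually.eventually_nhds hX

theorem SmoothFnNear.mdifferentiableAt {f : M → ℝ} {x : M} (hf : SmoothFnNear I f x) :
    MDiffAt f x := hf.self_of_nhds.mdifferentiableAt (by simp)

theorem SmoothFnNear.eventually {f : M → ℝ} {x : M}
    (hf : SmoothFnNear I f x) : ∀ᶠ y in 𝓝 x, SmoothFnNear I f y :=
  Filter.Eventually.eventually_nhds hf

theorem SmoothFieldNear.congr {X Y : Π x : M, TangentSpace I x} {x : M}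
    (hX : SmoothFieldNear X x) (h : ∀ᶠ y in 𝓝 x, Y y = X y) : SmoothFieldNear Y x := by
  filter_upwards [hX, h.eventually_nhds] with y hy hy'
  refine ContMDiffAt.congr_of_eventuallyEq hy ?_
  filter_upwards [hy'] with z hz
  rw [hz]

theorem SmoothFieldNear.add {X Y : Π x : M, TangentSpace I x} {x : M}
    (hX : SmoothFieldNear X x) (hY : SmoothFieldNear Y x) : SmoothFieldNear (X + Y) x := by
  filter_upwards [hX, hY] with y hy hy'
  exact ContMDiffAt.add_section hy hy'

theorem SmoothFieldNear.sub {X Y : Π x : M, TangentSpace I x} {x : M}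
    (hX : SmoothFieldNear X x) (hY : SmoothFieldNear Y x) : SmoothFieldNear (X - Y) x := by
  filter_upwards [hX, hY] with y hy hy'
  exact ContMDiffAt.sub_section hy hy'

theorem SmoothFieldNear.smul {f : M → ℝ} {X : Π x : M, TangentSpace I x} {x : M}
    (hf : SmoothFnNear I f x) (hX : SmoothFieldNear X x) : SmoothFieldNear (f • X) x := by
  filter_upwards [hf, hX] with y hy hy'
  exact ContMDiffAt.smul_section hy hy'

theorem SmoothFieldNear.const_smul (c : ℝ) {X : Π x : M, TangentSpace I x} {x : M}
    (hX : SmoothFieldNear X x) : SmoothFieldNear (c • X) x := by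
  filter_upwards [hX] with y hy'
  exact ContMDiffAt.const_smul_section hy'

theorem SmoothFieldNear.sum {ι : Type*} (s : Finset ι) {X : ι → Π x : M, TangentSpace I x} {x : M}
    (hX : ∀ i ∈ s, SmoothFieldNear (X i) x) : SmoothFieldNear (fun y ↦ ∑ i ∈ s, X i y) x := by
  have h : ∀ᶠ y in 𝓝 x, ∀ i ∈ s, SmoothFieldAt I (X i) y :=
    (Filter.eventually_all_finset s).2 hX
  filter_upwards [h] with y hy
  exact ContMDiffAt.sum_section hy

theorem SmoothFnNear.inner {X Y : Π x : M, TangentSpace I x} {x : M}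
    (hX : SmoothFieldNear X x) (hY : SmoothFieldNear Y x) :
    SmoothFnNear I (fun y ↦ (inner ℝ (X y) (Y y) : ℝ)) x := by
  filter_upwards [hX, hY] with y hy hy'
  exact ContMDiffAt.inner_bundle (E := fun x : M ↦ TangentSpace I x) (F := E) (IB := I)
    (b := fun y ↦ y) hy hy'

theorem smoothFieldNear_ext {x : M} (v : TangentSpace I x) : SmoothFieldNear (ext I v) x := by
  obtain ⟨s, hs, h⟩ := FiberBundle.exists_contMDiffOn_extend (k := ∞) I E v
  filter_upwards [eventually_mem_nhds_iff.2 hs] with y hy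
  exact h.contMDiffAt hy

theorem SmoothFieldNear.mlieBracket {X Y : Π x : M, TangentSpace I x} {x : M}
    (hX : SmoothFieldNear X x) (hY : SmoothFieldNear Y x) :
    SmoothFieldNear (mlieBracket I X Y) x := by
  have : IsManifold I (minSmoothness ℝ 2) M :=
    IsManifold.of_le (n := ∞) (by simpa using ENat.LEInfty.out)
  have : IsManifold I (((⊤ : ℕ∞) : WithTop ℕ∞) + 1) M := inferInstanceAs (IsManifold I ∞ M)
  filter_upwards [hX, hY] with y hy hy'
  exact ContMDiffAt.mlieBracket_vectorField (n := ⊤) (m := ⊤) hy hy' (by simp)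

theorem SmoothFnNear.mvfderiv {f : M → ℝ} {X : Π x : M, TangentSpace I x} {x : M}
    (hf : SmoothFnNear I f x) (hX : SmoothFieldNear X x) :
    SmoothFnNear I (fun y ↦ mvfderiv I f y (X y)) x := by
  filter_upwards [hf, hX] with y hy hy'
  have h1 : ContMDiffAt I 𝓘(ℝ, E →L[ℝ] ℝ) ∞
      (inTangentCoordinates I 𝓘(ℝ, ℝ) id f (mfderiv I 𝓘(ℝ, ℝ) f) y) y :=
    hy.mfderiv_const (by simp)
  have h2 := ContMDiffAt.clm_apply_of_inCoordinates (E₁ := fun x : M ↦ TangentSpace I x)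
    (F₁ := E) (F₂ := ℝ) (E₂ := fun x : ℝ ↦ TangentSpace 𝓘(ℝ, ℝ) x) (b₁ := fun y : M ↦ y) (b₂ := f)
    (ϕ := fun y ↦ mfderiv I 𝓘(ℝ, ℝ) f y) (v := X) h1 hy' hy
  have h3 := (Bundle.contMDiffAt_totalSpace.1 h2).2
  simpa using! h3

theorem SmoothFieldAt.contMDiffAt_minSmoothness {X : Π x : M, TangentSpace I x} {x : M}
    (hX : SmoothFieldAt I X x) : CMDiffAt (minSmoothness ℝ 2) (T% X) x :=
  ContMDiffAt.of_le (n := ∞) hX (by simpa using ENat.LEInfty.out)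

/-- The Jacobi identity. -/
theorem mlieBracket_jacobi {X Y Z : Π x : M, TangentSpace I x} {x : M}
    (hX : SmoothFieldAt I X x) (hY : SmoothFieldAt I Y x) (hZ : SmoothFieldAt I Z x) :
    mlieBracket I X (mlieBracket I Y Z) x =
      mlieBracket I (mlieBracket I X Y) Z x + mlieBracket I Y (mlieBracket I X Z) x := by
  have : IsManifold I (minSmoothness ℝ 3) M :=
    IsManifold.of_le (n := ∞) (by simpa using ENat.LEInfty.out)
  exact leibniz_identity_mlieBracket_apply hX.contMDiffAt_minSmoothness
    hY.contMDiffAt_minSmoothness hZ.contMDiffAt_minSmoothness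

theorem mlieBracket_mlieBracket_smul {X Y Z : Π x : M, TangentSpace I x} {f : M → ℝ} {x : M}
    (hY : SmoothFieldNear Y x) (hZ : SmoothFieldNear Z x) (hf : SmoothFnNear I f x) :
    mlieBracket I X (mlieBracket I Y (f • Z)) x =
      (mvfderiv I (fun y ↦ mvfderiv I f y (Y y)) x (X x) • Z x
        + mvfderiv I f x (Y x) • mlieBracket I X Z x)
      + (mvfderiv I f x (X x) • mlieBracket I Y Z x
        + f x • mlieBracket I X (mlieBracket I Y Z) x) := by
  have h1 : mlieBracket I Y (f • Z) =ᶠ[𝓝 x]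
      (fun y ↦ mvfderiv I f y (Y y)) • Z + f • mlieBracket I Y Z := by
    filter_upwards [hf.eventually, hZ.eventually] with y hy hy'
    exact mlieBracket_smul_right hy.mdifferentiableAt hy'.mdifferentiableAt
  have h2 := (SmoothFnNear.mvfderiv hf hY)
  have h3 := hY.mlieBracket hZ
  rw [(Filter.EventuallyEq.refl (𝓝 x) X).mlieBracket_vectorField_eq h1,
    mlieBracket_add_right (SmoothFieldNear.smul h2 hZ).mdifferentiableAt
      (SmoothFieldNear.smul hf h3).mdifferentiableAt,
    mlieBracket_smul_right h2.mdifferentiableAt hZ.mdifferentiableAt,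
    mlieBracket_smul_right hf.mdifferentiableAt h3.mdifferentiableAt]

/-- The Lie bracket of two vector fields is the commutator of the associated derivations. -/
theorem mvfderiv_mlieBracket {X Y : Π x : M, TangentSpace I x} {f : M → ℝ} {x : M}
    (hX : SmoothFieldNear X x) (hY : SmoothFieldNear Y x) (hf : SmoothFnNear I f x) :
    mvfderiv I f x (mlieBracket I X Y x) =
      mvfderiv I (fun y ↦ mvfderiv I f y (Y y)) x (X x)
        - mvfderiv I (fun y ↦ mvfderiv I f y (X y)) x (Y x) := by
  by_cases h : ∃ v : TangentSpace I x, v ≠ 0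
  · obtain ⟨v, hv⟩ := h
    have hZ := smoothFieldNear_ext v
    have hZx := ext_self v
    set Z := ext I v
    have hJ := mlieBracket_jacobi hX.at hY.at (SmoothFieldNear.smul hf hZ).at
    have hJ' := mlieBracket_jacobi hX.at hY.at hZ.at
    rw [mlieBracket_mlieBracket_smul hY hZ hf, mlieBracket_mlieBracket_smul hX hZ hf,
      mlieBracket_smul_right hf.mdifferentiableAt hZ.mdifferentiableAt, hJ', hZx] at hJ
    have : (mvfderiv I f x (mlieBracket I X Y x)) • v =
      (mvfderiv I (fun y ↦ mvfderiv I f y (Y y)) x (X x)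
        - mvfderiv I (fun y ↦ mvfderiv I f y (X y)) x (Y x)) • v := by
      rw [sub_smul, ← sub_eq_zero]
      rw [← sub_eq_zero] at hJ
      rw [← neg_eq_zero, ← hJ]
      module
    exact smul_left_injective ℝ hv this
  · push Not at h
    rw [h (X x), h (Y x), h (mlieBracket I X Y x)]
    simp

theorem SmoothFnNear.continuousAt {f : M → ℝ} {x : M} (hf : SmoothFnNear I f x) :
    ContinuousAt f x := hf.self_of_nhds.continuousAt

theorem SmoothFnNear.mul {f g : M → ℝ} {x : M} (hf : SmoothFnNear I f x)
    (hg : SmoothFnNear I g x) : SmoothFnNear I (fun y ↦ f y * g y) x := by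
  filter_upwards [hf, hg] with y hy hy'
  exact hy.mul hy'

theorem SmoothFnNear.add {f g : M → ℝ} {x : M} (hf : SmoothFnNear I f x)
    (hg : SmoothFnNear I g x) : SmoothFnNear I (fun y ↦ f y + g y) x := by
  filter_upwards [hf, hg] with y hy hy'
  exact hy.add hy'

theorem SmoothFnNear.sub {f g : M → ℝ} {x : M} (hf : SmoothFnNear I f x)
    (hg : SmoothFnNear I g x) : SmoothFnNear I (fun y ↦ f y - g y) x := by
  filter_upwards [hf, hg] with y hy hy'
  exact hy.sub hy'

theorem SmoothFnNear.inv {f : M → ℝ} {x : M} (hf : SmoothFnNear I f x) (h : f x ≠ 0) :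
    SmoothFnNear I (fun y ↦ (f y)⁻¹) x := by
  filter_upwards [hf, hf.continuousAt.eventually_ne h] with y hy hy'
  exact hy.inv₀ hy'

theorem SmoothFnNear.sqrt {f : M → ℝ} {x : M} (hf : SmoothFnNear I f x) (h : f x ≠ 0) :
    SmoothFnNear I (fun y ↦ √(f y)) x := by
  filter_upwards [hf, hf.continuousAt.eventually_ne h] with y hy hy'
  exact (Real.contDiffAt_sqrt hy').contMDiffAt.comp y hy

theorem SmoothFnNear.congr {f g : M → ℝ} {x : M} (hf : SmoothFnNear I f x)
    (h : ∀ᶠ y in 𝓝 x, g y = f y) : SmoothFnNear I g x := by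
  filter_upwards [hf, h.eventually_nhds] with y hy hy'
  exact hy.congr_of_eventuallyEq hy'

open InnerProductSpace in
theorem smoothFieldNear_gramSchmidt {d : ℕ} {X : Fin d → Π x : M, TangentSpace I x} {x : M}
    (hX : ∀ i, SmoothFieldNear (X i) x) (ho : Orthonormal ℝ (fun i ↦ X i x)) (i : Fin d) :
    SmoothFieldNear (fun y ↦ gramSchmidt ℝ (fun j ↦ X j y) i) x := by
  have hgx : gramSchmidt ℝ (fun i ↦ X i x) = fun i ↦ X i x :=
    gramSchmidt_of_orthogonal ℝ fun i j hij ↦ ho.2 hij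
  induction i using WellFoundedLT.induction with
  | ind i ih =>
  have key : ∀ y, gramSchmidt ℝ (fun j ↦ X j y) i = X i y - ∑ j ∈ Finset.Iio i,
      ((inner ℝ (gramSchmidt ℝ (fun j ↦ X j y) j) (X i y) : ℝ) *
        (inner ℝ (gramSchmidt ℝ (fun j ↦ X j y) j) (gramSchmidt ℝ (fun j ↦ X j y) j) : ℝ)⁻¹)
        • gramSchmidt ℝ (fun j ↦ X j y) j := by
    intro y
    have := gramSchmidt_def'' ℝ (fun j ↦ X j y) i
    rw [eq_sub_iff_add_eq]
    conv_rhs => rw [this]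
    congr 1
    refine Finset.sum_congr rfl fun j _ ↦ ?_
    rw [real_inner_self_eq_norm_sq, div_eq_mul_inv]
    rfl
  refine SmoothFieldNear.congr (X := X i - fun y ↦ ∑ j ∈ Finset.Iio i,
      ((inner ℝ (gramSchmidt ℝ (fun j ↦ X j y) j) (X i y) : ℝ) *
        (inner ℝ (gramSchmidt ℝ (fun j ↦ X j y) j) (gramSchmidt ℝ (fun j ↦ X j y) j) : ℝ)⁻¹)
        • gramSchmidt ℝ (fun j ↦ X j y) j) ?_ (Filter.Eventually.of_forall key)
  refine (hX i).sub (SmoothFieldNear.sum _ fun j hj ↦ ?_)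
  have hj' := ih j (Finset.mem_Iio.1 hj)
  refine SmoothFieldNear.smul (SmoothFnNear.mul (SmoothFnNear.inner hj' (hX i))
    (SmoothFnNear.inv (SmoothFnNear.inner hj' hj') ?_)) hj'
  rw [hgx, real_inner_self_eq_norm_sq, ho.1 j]
  norm_num

/-- A local orthonormal frame extending the given orthonormal basis of `T_x M`. -/
theorem exists_orthonormal_frame (x : M) :
    ∃ e : Fin (Module.finrank ℝ (TangentSpace I x)) → Π y : M, TangentSpace I y,
      (∀ i, SmoothFieldNear (e i) x) ∧ (∀ i, e i x = frame I x i) ∧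
      ∀ᶠ y in 𝓝 x, ∃ b : OrthonormalBasis (Fin (Module.finrank ℝ (TangentSpace I x))) ℝ
        (TangentSpace I y), ∀ i, b i = e i y := by
  set X : Fin (Module.finrank ℝ (TangentSpace I x)) → Π y : M, TangentSpace I y :=
    fun i ↦ ext I (frame I x i) with hXdef
  have hX : ∀ i, SmoothFieldNear (X i) x := fun i ↦ smoothFieldNear_ext _
  have hXx : (fun i ↦ X i x) = frame I x := by
    funext i
    exact ext_self _
  have ho : Orthonormal ℝ (fun i ↦ X i x) := by
    rw [hXx]
    exact (frame I x).orthonormal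
  set g := fun i (y : M) ↦ InnerProductSpace.gramSchmidt ℝ (fun j ↦ X j y) i with hgdef
  have hg : ∀ i, SmoothFieldNear (g i) x := smoothFieldNear_gramSchmidt hX ho
  have hgx : ∀ i, g i x = frame I x i := by
    intro i
    have := InnerProductSpace.gramSchmidt_of_orthogonal ℝ (f := fun i ↦ X i x)
      fun i j hij ↦ ho.2 hij
    simp only [hgdef, this]
    exact congrFun hXx i
  have hn : ∀ i, (inner ℝ (g i x) (g i x) : ℝ) = 1 := by
    intro i
    rw [hgx, real_inner_self_eq_norm_sq, (frame I x).norm_eq_one]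
    norm_num
  have hn0 : ∀ᶠ y in 𝓝 x, ∀ i, (inner ℝ (g i y) (g i y) : ℝ) ≠ 0 := by
    refine Filter.eventually_all.2 fun i ↦ ?_
    refine (SmoothFnNear.inner (hg i) (hg i)).continuousAt.eventually_ne ?_
    rw [hn]
    norm_num
  refine ⟨fun i y ↦ (√(inner ℝ (g i y) (g i y)))⁻¹ • g i y, fun i ↦ ?_, fun i ↦ ?_, ?_⟩
  · refine SmoothFieldNear.smul (SmoothFnNear.inv (SmoothFnNear.sqrt
      (SmoothFnNear.inner (hg i) (hg i)) ?_) ?_) (hg i) <;> rw [hn] <;> norm_num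
  · simp only [hgx]
    simp
  · filter_upwards [hn0] with y hy
    have hon : Orthonormal ℝ (fun i ↦ (√(inner ℝ (g i y) (g i y)))⁻¹ • g i y) := by
      refine ⟨fun i ↦ ?_, fun i j hij ↦ ?_⟩
      · have h0 : ‖g i y‖ ≠ 0 := fun h ↦ hy i (by rw [real_inner_self_eq_norm_sq, h]; norm_num)
        beta_reduce
        rw [real_inner_self_eq_norm_sq, Real.sqrt_sq (norm_nonneg _), norm_smul, norm_inv,
          norm_norm, inv_mul_cancel₀ h0]
      · simp only [inner_smul_left, inner_smul_right]
        have : (inner ℝ (g i y) (g j y) : ℝ) = 0 :=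
          InnerProductSpace.gramSchmidt_orthogonal ℝ (fun j ↦ X j y) hij
        rw [this]
        simp
    obtain ⟨b, hb⟩ := Orthonormal.exists_orthonormalBasis_extension_of_card_eq
      (𝕜 := ℝ) (E := TangentSpace I y) (ι := Fin (Module.finrank ℝ (TangentSpace I x)))
      (by rw [Fintype.card_fin]; rfl)
      (v := fun i ↦ (√(inner ℝ (g i y) (g i y)))⁻¹ • g i y) (s := Set.univ)
      (hon.comp _ Subtype.val_injective)
    exact ⟨b, fun i ↦ hb i trivial⟩

/-- A vector field is smooth near `x` as soon as its inner products with all smooth vector fields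
are. -/
theorem SmoothFieldNear.of_inner {X : Π x : M, TangentSpace I x} {x : M}
    (h : ∀ Z : Π x : M, TangentSpace I x, SmoothFieldNear Z x →
      SmoothFnNear I (fun y ↦ (inner ℝ (X y) (Z y) : ℝ)) x) : SmoothFieldNear X x := by
  obtain ⟨e, he, -, hb⟩ := exists_orthonormal_frame (I := I) x
  refine SmoothFieldNear.congr (X := fun y ↦ ∑ i, (inner ℝ (X y) (e i y) : ℝ) • e i y)
    (SmoothFieldNear.sum _ fun i _ ↦ SmoothFieldNear.smul (h _ (he i)) (he i)) ?_
  filter_upwards [hb] with y ⟨b, hb⟩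
  conv_lhs => rw [← b.sum_repr' (X y)]
  refine Finset.sum_congr rfl fun i _ ↦ ?_
  rw [hb, real_inner_comm]

theorem SmoothFnNear.const_mul (c : ℝ) {f : M → ℝ} {x : M} (hf : SmoothFnNear I f x) :
    SmoothFnNear I (fun y ↦ c * f y) x := by
  filter_upwards [hf] with y hy
  exact contMDiffAt_const.mul hy

theorem SmoothFnNear.koszul {X Y Z : Π x : M, TangentSpace I x} {x : M}
    (hX : SmoothFieldNear X x) (hY : SmoothFieldNear Y x) (hZ : SmoothFieldNear Z x) :
    SmoothFnNear I (koszul I X Y Z) x := by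
  have h1 := SmoothFnNear.mvfderiv (SmoothFnNear.inner hY hZ) hX
  have h2 := SmoothFnNear.mvfderiv (SmoothFnNear.inner hZ hX) hY
  have h3 := SmoothFnNear.mvfderiv (SmoothFnNear.inner hX hY) hZ
  have h4 := SmoothFnNear.inner (hX.mlieBracket hY) hZ
  have h5 := SmoothFnNear.inner (hY.mlieBracket hZ) hX
  have h6 := SmoothFnNear.inner (hZ.mlieBracket hX) hY
  exact ((((h1.add h2).sub h3).add h4).sub h5).add h6

/-- The covariant derivative of smooth vector fields is smooth. -/
theorem SmoothFieldNear.nabla {X Y : Π x : M, TangentSpace I x} {x : M}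
    (hX : SmoothFieldNear X x) (hY : SmoothFieldNear Y x) : SmoothFieldNear (nabla I X Y) x := by
  refine SmoothFieldNear.of_inner fun Z hZ ↦ ?_
  refine SmoothFnNear.congr ((SmoothFnNear.koszul hX hY hZ).const_mul (1 / 2)) ?_
  filter_upwards [hX.eventually, hY.eventually, hZ.eventually] with y h1 h2 h3
  rw [inner_nabla h1.mdifferentiableAt h2.mdifferentiableAt h3.mdifferentiableAt]
  ring

theorem inner_grad (f : M → ℝ) (x : M) (v : TangentSpace I x) :
    inner ℝ (grad I f x) v = mvfderiv I f x v :=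
  sharp_inner x (mvfderiv I f x).toLinearMap v

theorem SmoothFieldNear.grad {f : M → ℝ} {x : M} (hf : SmoothFnNear I f x) :
    SmoothFieldNear (grad I f) x := by
  refine SmoothFieldNear.of_inner fun Z hZ ↦ ?_
  simp only [inner_grad]
  exact SmoothFnNear.mvfderiv hf hZ

end Smooth

section Curvature

variable {E : Type*} [NormedAddCommGroup E] [NormedSpace ℝ E] [FiniteDimensional ℝ E]
  {H : Type*} [TopologicalSpace H] {I : ModelWithCorners ℝ E H}
  {M : Type*} [TopologicalSpace M] [ChartedSpace H M] [IsManifold I ∞ M]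
  [RiemannianBundle (fun x : M ↦ TangentSpace I x)]
  [IsContMDiffRiemannianBundle I ∞ E (fun x : M ↦ TangentSpace I x)]

theorem mvfderiv_mvfderiv_inner {X Y Z W : Π x : M, TangentSpace I x} {x : M}
    (hX : SmoothFieldNear X x) (hY : SmoothFieldNear Y x) (hZ : SmoothFieldNear Z x)
    (hW : SmoothFieldNear W x) :
    mvfderiv I (fun y ↦ mvfderiv I (fun z ↦ (inner ℝ (Z z) (W z) : ℝ)) y (Y y)) x (X x) =
      (inner ℝ (nabla I X (nabla I Y Z) x) (W x) + inner ℝ (nabla I Y Z x) (nabla I X W x))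
      + (inner ℝ (nabla I X Z x) (nabla I Y W x)
        + inner ℝ (Z x) (nabla I X (nabla I Y W) x)) := by
  have h1 : (fun y ↦ mvfderiv I (fun z ↦ (inner ℝ (Z z) (W z) : ℝ)) y (Y y)) =ᶠ[𝓝 x]
      fun y ↦ (inner ℝ (nabla I Y Z y) (W y) : ℝ) + inner ℝ (Z y) (nabla I Y W y) := by
    filter_upwards [hY.eventually, hZ.eventually, hW.eventually] with y h1 h2 h3
    exact mvfderiv_inner h1.mdifferentiableAt h2.mdifferentiableAt h3.mdifferentiableAt
  have hYZ := hY.nabla hZ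
  have hYW := hY.nabla hW
  rw [mvfderiv_congr h1, mvfderiv_fun_add (SmoothFnNear.inner hYZ hW).mdifferentiableAt
    (SmoothFnNear.inner hZ hYW).mdifferentiableAt, add_apply,
    mvfderiv_inner hX.mdifferentiableAt hYZ.mdifferentiableAt hW.mdifferentiableAt,
    mvfderiv_inner hX.mdifferentiableAt hZ.mdifferentiableAt hYW.mdifferentiableAt]

/-- The curvature operator is skew-symmetric. -/
theorem inner_curvature_skew {X Y Z W : Π x : M, TangentSpace I x} {x : M}
    (hX : SmoothFieldNear X x) (hY : SmoothFieldNear Y x) (hZ : SmoothFieldNear Z x)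
    (hW : SmoothFieldNear W x) :
    (inner ℝ (curvature I X Y Z x) (W x) : ℝ) = - inner ℝ (curvature I X Y W x) (Z x) := by
  have h := mvfderiv_mlieBracket hX hY (SmoothFnNear.inner hZ hW)
  rw [mvfderiv_mvfderiv_inner hX hY hZ hW, mvfderiv_mvfderiv_inner hY hX hZ hW,
    mvfderiv_inner (hX.mlieBracket hY).mdifferentiableAt hZ.mdifferentiableAt
      hW.mdifferentiableAt] at h
  rw [real_inner_comm (Z x)]
  simp only [curvature, inner_sub_left, inner_sub_right]
  linarith

theorem curvature_swap {X Y Z : Π x : M, TangentSpace I x} {x : M}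
    (hX : SmoothFieldNear X x) (hY : SmoothFieldNear Y x) (hZ : SmoothFieldNear Z x) :
    curvature I X Y Z x = - curvature I Y X Z x := by
  have h : nabla I (mlieBracket I X Y) Z x = - nabla I (mlieBracket I Y X) Z x := by
    rw [← neg_one_smul ℝ, ← nabla_smul_left (f := fun _ ↦ (-1 : ℝ))
      (hY.mlieBracket hX).mdifferentiableAt hZ.mdifferentiableAt mdifferentiableAt_const]
    congr 1
    rw [mlieBracket_swap]
    funext y
    simp
  simp only [curvature, h]
  module

theorem nabla_sub_right {X Y Y' : Π x : M, TangentSpace I x} {x : M} (hX : MDiffAt (T% X) x)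
    (hY : MDiffAt (T% Y) x) (hY' : MDiffAt (T% Y') x) :
    nabla I X (Y - Y') x = nabla I X Y x - nabla I X Y' x := by
  rw [eq_sub_iff_add_eq, ← nabla_add_right hX (mdifferentiableAt_sub_section hY hY') hY',
    sub_add_cancel]

theorem nabla_nabla_sub {X Y Z : Π x : M, TangentSpace I x} {x : M}
    (hX : SmoothFieldNear X x) (hY : SmoothFieldNear Y x) (hZ : SmoothFieldNear Z x) :
    nabla I X (nabla I Y Z) x - nabla I X (nabla I Z Y) x
      = nabla I X (mlieBracket I Y Z) x := by
  rw [← nabla_sub_right hX.mdifferentiableAt (hY.nabla hZ).mdifferentiableAt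
    (hZ.nabla hY).mdifferentiableAt]
  refine nabla_congr_right X ?_
  filter_upwards [hY.eventually, hZ.eventually] with y h1 h2
  exact nabla_sub_nabla h1.mdifferentiableAt h2.mdifferentiableAt

/-- The first Bianchi identity. -/
theorem curvature_bianchi {X Y Z : Π x : M, TangentSpace I x} {x : M}
    (hX : SmoothFieldNear X x) (hY : SmoothFieldNear Y x) (hZ : SmoothFieldNear Z x) :
    curvature I X Y Z x + curvature I Y Z X x + curvature I Z X Y x = 0 := by
  have h1 := nabla_nabla_sub hX hY hZ
  have h2 := nabla_nabla_sub hY hZ hX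
  have h3 := nabla_nabla_sub hZ hX hY
  have t1 := nabla_sub_nabla hX.mdifferentiableAt (hY.mlieBracket hZ).mdifferentiableAt
  have t2 := nabla_sub_nabla hY.mdifferentiableAt (hZ.mlieBracket hX).mdifferentiableAt
  have t3 := nabla_sub_nabla hZ.mdifferentiableAt (hX.mlieBracket hY).mdifferentiableAt
  have hJ := mlieBracket_jacobi hX.at hY.at hZ.at
  rw [mlieBracket_swap_apply (V := mlieBracket I X Y), mlieBracket_swap (V := X) (W := Z)] at hJ
  have hJ' : mlieBracket I Y (-mlieBracket I Z X) x = - mlieBracket I Y (mlieBracket I Z X) x := by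
    rw [mlieBracket_swap_apply, ← neg_one_smul ℝ (mlieBracket I Z X),
      mlieBracket_const_smul_left (hZ.mlieBracket hX).mdifferentiableAt,
      mlieBracket_swap_apply (V := Y)]
    module
  rw [hJ', ← t1, ← t2, ← t3, ← h1, ← h2, ← h3] at hJ
  simp only [curvature]
  rw [← sub_eq_zero] at hJ
  rw [← hJ]
  module

/-- Pair symmetry of the curvature tensor. -/
theorem inner_curvature_pair {X Y Z W : Π x : M, TangentSpace I x} {x : M}
    (hX : SmoothFieldNear X x) (hY : SmoothFieldNear Y x) (hZ : SmoothFieldNear Z x)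
    (hW : SmoothFieldNear W x) :
    (inner ℝ (curvature I X Y Z x) (W x) : ℝ) = inner ℝ (curvature I Z W X x) (Y x) := by
  have b1 := congrArg (fun v ↦ (inner ℝ v (W x) : ℝ)) (curvature_bianchi hX hY hZ)
  have b2 := congrArg (fun v ↦ (inner ℝ v (X x) : ℝ)) (curvature_bianchi hY hZ hW)
  have b3 := congrArg (fun v ↦ (inner ℝ v (Y x) : ℝ)) (curvature_bianchi hZ hW hX)
  have b4 := congrArg (fun v ↦ (inner ℝ v (Z x) : ℝ)) (curvature_bianchi hW hX hY)
  simp only [inner_add_left, inner_zero_left] at b1 b2 b3 b4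
  have s1 := inner_curvature_skew hX hY hZ hW
  have s2 := inner_curvature_skew hY hZ hX hW
  have s3 := inner_curvature_skew hZ hX hY hW
  have s4 := inner_curvature_skew hZ hW hX hY
  have s5 := inner_curvature_skew hY hW hX hZ
  have s6 := inner_curvature_skew hX hW hY hZ
  have e1 := congrArg (fun v ↦ (inner ℝ v (X x) : ℝ)) (curvature_swap hW hY hZ)
  have e2 := congrArg (fun v ↦ (inner ℝ v (Z x) : ℝ)) (curvature_swap hW hY hX)
  have e3 := congrArg (fun v ↦ (inner ℝ v (Y x) : ℝ)) (curvature_swap hW hX hZ)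
  have e4 := congrArg (fun v ↦ (inner ℝ v (Z x) : ℝ)) (curvature_swap hW hX hY)
  have e5 := congrArg (fun v ↦ (inner ℝ v (W x) : ℝ)) (curvature_swap hZ hX hY)
  have e6 := congrArg (fun v ↦ (inner ℝ v (Y x) : ℝ)) (curvature_swap hX hZ hW)
  have s7 := inner_curvature_skew hX hY hW hZ
  have s8 := inner_curvature_skew hY hW hZ hX
  simp only [inner_neg_left] at e1 e2 e3 e4 e5 e6
  linarith

theorem curvature_congr₃ {X Y Z Z' : Π x : M, TangentSpace I x} {x : M}
    (hX : SmoothFieldNear X x) (hY : SmoothFieldNear Y x) (hZ : SmoothFieldNear Z x)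
    (hZ' : SmoothFieldNear Z' x) (h : Z x = Z' x) :
    curvature I X Y Z x = curvature I X Y Z' x := by
  refine ext_inner_right ℝ fun w ↦ ?_
  rw [← ext_self (I := I) w, inner_curvature_skew hX hY hZ (smoothFieldNear_ext w),
    inner_curvature_skew hX hY hZ' (smoothFieldNear_ext w), h]

/-- The curvature depends on the three vector fields only through their values at the point. -/
theorem curvature_congr {X X' Y Y' Z Z' : Π x : M, TangentSpace I x} {x : M}
    (hX : SmoothFieldNear X x) (hX' : SmoothFieldNear X' x) (hY : SmoothFieldNear Y x)
    (hY' : SmoothFieldNear Y' x) (hZ : SmoothFieldNear Z x) (hZ' : SmoothFieldNear Z' x)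
    (h1 : X x = X' x) (h2 : Y x = Y' x) (h3 : Z x = Z' x) :
    curvature I X Y Z x = curvature I X' Y' Z' x := by
  rw [curvature_congr₃ hX hY hZ hZ' h3]
  refine ext_inner_right ℝ fun w ↦ ?_
  have hw := smoothFieldNear_ext w
  rw [← ext_self (I := I) w, inner_curvature_pair hX hY hZ' hw, inner_curvature_pair hX' hY' hZ' hw,
    curvature_congr₃ hZ' hw hX hX' h1, h2]

/-- The Ricci tensor computed with arbitrary smooth extensions. -/
theorem ricci_eq_sum {x : M}
    {e : Fin (Module.finrank ℝ (TangentSpace I x)) → Π y : M, TangentSpace I y}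
    {U V : Π y : M, TangentSpace I y} (hU : SmoothFieldNear U x)
    (hV : SmoothFieldNear V x) (he : ∀ i, SmoothFieldNear (e i) x)
    (hex : ∀ i, e i x = frame I x i) :
    ricci I x (U x) (V x) = ∑ i, (inner ℝ (curvature I (e i) U V x) (e i x) : ℝ) := by
  refine Finset.sum_congr rfl fun i _ ↦ ?_
  rw [hex]
  congr 1
  exact curvature_congr (smoothFieldNear_ext _) (he i) (smoothFieldNear_ext _) hU
    (smoothFieldNear_ext _) hV (by rw [ext_self, hex]) (ext_self _) (ext_self _)

end Curvature

section AlmostCoKahler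

variable {E : Type*} [NormedAddCommGroup E] [NormedSpace ℝ E] [FiniteDimensional ℝ E]
  {H : Type*} [TopologicalSpace H] {I : ModelWithCorners ℝ E H}
  {M : Type*} [TopologicalSpace M] [ChartedSpace H M] [IsManifold I ∞ M]
  [RiemannianBundle (fun x : M ↦ TangentSpace I x)]
  [IsContMDiffRiemannianBundle I ∞ E (fun x : M ↦ TangentSpace I x)]

namespace AlmostContactMetric

variable (S : AlmostContactMetric I M)

theorem φ_ζ (x : M) : S.φ x (S.ζ x) = 0 := by
  have h1 : S.φ x (S.φ x (S.ζ x)) = 0 := by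
    have := S.φ_sq x (S.ζ x)
    rwa [S.η_ζ, one_smul, add_eq_right] at this
  have h2 := S.φ_sq x (S.φ x (S.ζ x))
  rw [h1, map_zero, zero_add] at h2
  by_cases h : S.η x (S.φ x (S.ζ x)) = 0
  · rw [h2, h, zero_smul]
  · have h3 := congrArg (S.φ x) h2
    rw [h1, map_smul] at h3
    exact (smul_eq_zero.1 h3.symm).resolve_left h

theorem η_eq_inner (x : M) (u : TangentSpace I x) : S.η x u = inner ℝ u (S.ζ x) := by
  rw [S.compat, φ_ζ, S.η_ζ, inner_zero_right]
  ring

theorem inner_ζ_ζ (x : M) : (inner ℝ (S.ζ x) (S.ζ x) : ℝ) = 1 := by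
  rw [← η_eq_inner, S.η_ζ]

theorem ζ_ne_zero (x : M) : S.ζ x ≠ 0 := by
  intro h
  have := S.inner_ζ_ζ x
  simp [h] at this

theorem φ_φ (x : M) (u : TangentSpace I x) : S.φ x (S.φ x u) = S.η x u • S.ζ x - u :=
  eq_sub_of_add_eq (S.φ_sq x u)

theorem η_φ (x : M) (u : TangentSpace I x) : S.η x (S.φ x u) = 0 := by
  have h1 := S.φ_φ x (S.φ x u)
  rw [S.φ_φ x u, map_sub, map_smul, φ_ζ, smul_zero, zero_sub] at h1
  have : S.η x (S.φ x u) • S.ζ x = 0 := by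
    rw [eq_comm, sub_eq_iff_eq_add, neg_add_cancel] at h1
    exact h1
  exact (smul_eq_zero.1 this).resolve_right (S.ζ_ne_zero x)

theorem inner_φ_right (x : M) (u v : TangentSpace I x) :
    (inner ℝ u (S.φ x v) : ℝ) = - inner ℝ (S.φ x u) v := by
  rw [S.compat x u, η_φ, φ_φ, inner_sub_right, inner_smul_right, ← η_eq_inner, η_φ]
  ring

theorem smoothFieldNear_ζ (x : M) : SmoothFieldNear S.ζ x :=
  Filter.Eventually.of_forall S.smooth_ζ

theorem smoothFieldNear_φ {X : Π x : M, TangentSpace I x} {x : M} (hX : SmoothFieldNear X x) :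
    SmoothFieldNear (fun y ↦ S.φ y (X y)) x := by
  filter_upwards [hX] with y hy
  exact ContMDiffAt.clm_bundle_apply (F₁ := E) (F₂ := E) (E₁ := fun x : M ↦ TangentSpace I x)
    (E₂ := fun x : M ↦ TangentSpace I x) (b := fun y ↦ y) (S.smooth_φ y) hy

/-- The endomorphism `u ↦ ∇_u ζ`. -/
noncomputable def covDerivζ (x : M) : TangentSpace I x →L[ℝ] TangentSpace I x :=
  TensorialAt.mkHom (fun X : Π x : M, TangentSpace I x ↦ nabla I X S.ζ x) x
    (nabla_tensorialAt (S.smoothFieldNear_ζ x).mdifferentiableAt)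

theorem nabla_ζ {X : Π x : M, TangentSpace I x} {x : M} (hX : MDiffAt (T% X) x) :
    nabla I X S.ζ x = S.covDerivζ x (X x) :=
  (TensorialAt.mkHom_apply (nabla_tensorialAt (S.smoothFieldNear_ζ x).mdifferentiableAt) hX).symm

theorem inner_covDerivζ_ζ (x : M) (u : TangentSpace I x) :
    (inner ℝ (S.covDerivζ x u) (S.ζ x) : ℝ) = 0 := by
  have hu := mdifferentiableAt_ext u
  have hζ := (S.smoothFieldNear_ζ x).mdifferentiableAt
  have h := mvfderiv_inner hu hζ hζ
  simp only [inner_ζ_ζ, mvfderiv_const, S.nabla_ζ hu, ext_self] at h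
  rw [real_inner_comm (S.covDerivζ x u) (S.ζ x)] at h
  simp only [zero_apply] at h
  linarith

variable {S}

theorem IsAlmostCoKahler.inner_covDerivζ_comm (hS : S.IsAlmostCoKahler) (x : M)
    (u v : TangentSpace I x) :
    (inner ℝ (S.covDerivζ x u) v : ℝ) = inner ℝ u (S.covDerivζ x v) := by
  have hu := smoothFieldNear_ext u
  have hv := smoothFieldNear_ext v
  have hζ := (S.smoothFieldNear_ζ x).mdifferentiableAt
  have h := hS.1 x _ _ hu.at hv.at
  simp only [extDeriv₁, η_eq_inner] at h
  rw [mvfderiv_inner hu.mdifferentiableAt hv.mdifferentiableAt hζ,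
    mvfderiv_inner hv.mdifferentiableAt hu.mdifferentiableAt hζ,
    ← nabla_sub_nabla hu.mdifferentiableAt hv.mdifferentiableAt, inner_sub_left,
    S.nabla_ζ hu.mdifferentiableAt, S.nabla_ζ hv.mdifferentiableAt] at h
  simp only [ext_self] at h
  rw [real_inner_comm v]
  linarith

theorem IsAlmostCoKahler.covDerivζ_ζ (hS : S.IsAlmostCoKahler) (x : M) :
    S.covDerivζ x (S.ζ x) = 0 := by
  refine ext_inner_right ℝ fun w ↦ ?_
  rw [hS.inner_covDerivζ_comm, real_inner_comm, inner_covDerivζ_ζ, inner_zero_left]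

/-- `(£_ζ φ) Y = -2 ∇_{φ Y} ζ`. -/
theorem IsAlmostCoKahler.lie_φ (hS : S.IsAlmostCoKahler) {Y : Π x : M, TangentSpace I x} {x : M}
    (hY : SmoothFieldNear Y x) :
    mlieBracket I S.ζ (fun y ↦ S.φ y (Y y)) x - S.φ x (mlieBracket I S.ζ Y x)
      = (-2 : ℝ) • S.covDerivζ x (S.φ x (Y x)) := by
  refine ext_inner_left ℝ fun w ↦ ?_
  obtain ⟨X, hX, rfl⟩ : ∃ X : Π x : M, TangentSpace I x, SmoothFieldNear X x ∧ X x = w :=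
    ⟨ext I w, smoothFieldNear_ext w, ext_self w⟩
  have hζ := S.smoothFieldNear_ζ x
  have hφY := S.smoothFieldNear_φ hY
  have h := hS.2 x _ _ _ hζ.at hX.at hY.at
  have e1 : ∀ y, ∀ u : TangentSpace I y, S.fundamentalForm y u (S.ζ y) = 0 := by
    intro y u
    simp [fundamentalForm, φ_ζ]
  have e2 : ∀ y, ∀ u : TangentSpace I y, S.fundamentalForm y (S.ζ y) u = 0 := by
    intro y u
    rw [fundamentalForm, inner_φ_right, φ_ζ, inner_zero_left, neg_zero]
  simp only [extDeriv₂, e1, e2, mvfderiv_const, zero_apply] at h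
  simp only [fundamentalForm] at h
  rw [mvfderiv_inner hζ.mdifferentiableAt hX.mdifferentiableAt hφY.mdifferentiableAt,
    mlieBracket_swap_apply (V := Y), inner_neg_left,
    ← nabla_sub_nabla hζ.mdifferentiableAt hX.mdifferentiableAt, inner_sub_left,
    S.nabla_ζ hX.mdifferentiableAt, inner_φ_right S x (mlieBracket I S.ζ Y x)] at h
  have h5 : (inner ℝ (S.φ x (mlieBracket I S.ζ Y x)) (X x) : ℝ) =
    inner ℝ (X x) (S.φ x (mlieBracket I S.ζ Y x)) := real_inner_comm _ _
  rw [← nabla_sub_nabla hζ.mdifferentiableAt hφY.mdifferentiableAt, inner_sub_right,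
    inner_sub_right, inner_smul_right, S.nabla_ζ hφY.mdifferentiableAt,
    ← hS.inner_covDerivζ_comm]
  linarith

theorem IsAlmostCoKahler.h_eq (hS : S.IsAlmostCoKahler) (x : M) (u : TangentSpace I x) :
    S.h x u = - S.covDerivζ x (S.φ x u) := by
  rw [h, hS.lie_φ (smoothFieldNear_ext u), ext_self]
  module

theorem IsAlmostCoKahler.mlieBracket_η_smul (hS : S.IsAlmostCoKahler)
    {Y : Π x : M, TangentSpace I x} {x : M} (hY : SmoothFieldNear Y x) :
    mlieBracket I S.ζ ((fun y ↦ S.η y (Y y)) • S.ζ) x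
      = S.η x (mlieBracket I S.ζ Y x) • S.ζ x := by
  have hζ := S.smoothFieldNear_ζ x
  have hη : SmoothFnNear I (fun y ↦ S.η y (Y y)) x := by
    simp only [η_eq_inner]
    exact SmoothFnNear.inner hY hζ
  rw [mlieBracket_smul_right hη.mdifferentiableAt hζ.mdifferentiableAt, mlieBracket_self]
  have h := hS.1 x _ _ hζ.at hY.at
  simp only [extDeriv₁, S.η_ζ, mvfderiv_const, zero_apply, sub_zero] at h
  rw [sub_eq_zero.1 h]
  simp

theorem IsAlmostCoKahler.covDerivζ_φ (hS : S.IsAlmostCoKahler) (x : M) (u : TangentSpace I x) :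
    S.covDerivζ x (S.φ x u) = - S.φ x (S.covDerivζ x u) := by
  have key : ∀ v, S.covDerivζ x (S.φ x (S.φ x v)) + S.φ x (S.covDerivζ x (S.φ x v)) = 0 := by
    intro v
    have hζ := S.smoothFieldNear_ζ x
    obtain ⟨Y, hY, rfl⟩ : ∃ X : Π x : M, TangentSpace I x, SmoothFieldNear X x ∧ X x = v :=
      ⟨ext I v, smoothFieldNear_ext v, ext_self v⟩
    have hφY := S.smoothFieldNear_φ hY
    have h1 := hS.lie_φ hφY
    have h2 := congrArg (S.φ x) (hS.lie_φ hY)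
    have hη : SmoothFnNear I (fun y ↦ S.η y (Y y)) x := by
      simp only [η_eq_inner]
      exact SmoothFnNear.inner hY hζ
    have h3 : (fun y ↦ S.φ y (S.φ y (Y y)))
        = (fun y ↦ S.η y (Y y)) • S.ζ + (-1 : ℝ) • Y := by
      funext y
      simp [φ_φ, sub_eq_add_neg]
    rw [h3, mlieBracket_add_right (SmoothFieldNear.smul hη hζ).mdifferentiableAt
      (hY.const_smul (-1)).mdifferentiableAt, hS.mlieBracket_η_smul hY,
      mlieBracket_const_smul_right hY.mdifferentiableAt] at h1
    rw [map_sub, φ_φ, map_smul] at h2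
    have h4 : (-2 : ℝ) • (S.covDerivζ x (S.φ x (S.φ x (Y x)))
        + S.φ x (S.covDerivζ x (S.φ x (Y x)))) = 0 := by
      rw [smul_add, ← h1, ← h2]
      module
    exact (smul_eq_zero.1 h4).resolve_left (by norm_num)
  have h1 := key (S.φ x u)
  rw [φ_φ S x (S.φ x u), η_φ, zero_smul, zero_sub, map_neg, φ_φ, map_sub, map_smul,
    hS.covDerivζ_ζ, smul_zero, zero_sub, map_neg] at h1
  rwa [neg_add_eq_zero] at h1

/-- The trace of `u ↦ ∇_u ζ` vanishes, that is, `ζ` is divergence-free. -/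
theorem IsAlmostCoKahler.sum_inner_covDerivζ (hS : S.IsAlmostCoKahler) {x : M} {ι : Type*}
    [Fintype ι] (b : OrthonormalBasis ι ℝ (TangentSpace I x)) :
    ∑ i, (inner ℝ (S.covDerivζ x (b i)) (b i) : ℝ) = 0 := by
  set A : TangentSpace I x →ₗ[ℝ] TangentSpace I x := (S.covDerivζ x).toLinearMap with hA
  set F : TangentSpace I x →ₗ[ℝ] TangentSpace I x := (S.φ x).toLinearMap with hF
  have h1 : A = -(A * (F * F)) := by
    ext u
    simp only [LinearMap.neg_apply, Module.End.mul_apply, hA, hF, ContinuousLinearMap.coe_coe,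
      φ_φ, map_sub, map_smul, hS.covDerivζ_ζ]
    simp
  have h2 : A * F = -(F * A) := by
    ext u
    exact hS.covDerivζ_φ x u
  have h3 : LinearMap.trace ℝ _ (A * (F * F)) = 0 := by
    have : LinearMap.trace ℝ _ (A * (F * F)) = -LinearMap.trace ℝ _ (A * (F * F)) := by
      conv_lhs => rw [← mul_assoc, h2, neg_mul, map_neg, mul_assoc, LinearMap.trace_mul_comm,
        mul_assoc]
    linarith
  have h4 : LinearMap.trace ℝ _ A = 0 := by rw [h1, map_neg, h3, neg_zero]
  rw [LinearMap.trace_eq_sum_inner A b] at h4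
  rw [← h4]
  exact Finset.sum_congr rfl fun i _ ↦ real_inner_comm _ _

end AlmostContactMetric
end AlmostCoKahler

section Ricci

variable {E : Type*} [NormedAddCommGroup E] [NormedSpace ℝ E] [FiniteDimensional ℝ E]
  {H : Type*} [TopologicalSpace H] {I : ModelWithCorners ℝ E H}
  {M : Type*} [TopologicalSpace M] [ChartedSpace H M] [IsManifold I ∞ M]
  [RiemannianBundle (fun x : M ↦ TangentSpace I x)]
  [IsContMDiffRiemannianBundle I ∞ E (fun x : M ↦ TangentSpace I x)]

theorem mvfderiv_const_mul (c : ℝ) {f : M → ℝ} {x : M} (hf : MDiffAt f x) (v : TangentSpace I x) :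
    mvfderiv I (fun y ↦ c * f y) x v = c * mvfderiv I f x v := by
  rw [mvfderiv_fun_mul mdifferentiableAt_const hf, mvfderiv_const]
  simp

theorem SmoothFnNear.sum {ι : Type*} (s : Finset ι) {f : ι → M → ℝ} {x : M}
    (hf : ∀ i ∈ s, SmoothFnNear I (f i) x) : SmoothFnNear I (fun y ↦ ∑ i ∈ s, f i y) x := by
  classical
  induction s using Finset.induction_on with
  | empty =>
    simp only [Finset.sum_empty]
    exact Filter.Eventually.of_forall fun y ↦ contMDiffAt_const
  | insert a s ha ih =>
    simp only [Finset.sum_insert ha]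
    exact (hf a (Finset.mem_insert_self a s)).add
      (ih fun i hi ↦ hf i (Finset.mem_insert_of_mem hi))

theorem mvfderiv_sum {ι : Type*} (s : Finset ι) {f : ι → M → ℝ} {x : M}
    (hf : ∀ i ∈ s, SmoothFnNear I (f i) x) (v : TangentSpace I x) :
    mvfderiv I (fun y ↦ ∑ i ∈ s, f i y) x v = ∑ i ∈ s, mvfderiv I (f i) x v := by
  classical
  induction s using Finset.induction_on with
  | empty => simp [mvfderiv_const]
  | insert a s ha ih =>
    have hs : ∀ i ∈ s, SmoothFnNear I (f i) x := fun i hi ↦ hf i (Finset.mem_insert_of_mem hi)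
    simp only [Finset.sum_insert ha]
    rw [mvfderiv_fun_add (hf a (Finset.mem_insert_self a s)).mdifferentiableAt
      (SmoothFnNear.sum s hs).mdifferentiableAt, add_apply, ih hs]

theorem nabla_zero_right {X : Π x : M, TangentSpace I x} {x : M} (hX : MDiffAt (T% X) x) :
    nabla I X (0 : Π x : M, TangentSpace I x) x = 0 := by
  have h := nabla_smul_right (f := fun _ : M ↦ (0 : ℝ)) hX hX mdifferentiableAt_const
  have h0 : (fun _ : M ↦ (0 : ℝ)) • X = (0 : Π x : M, TangentSpace I x) := by
    funext y
    simp
  rw [h0, mvfderiv_const] at h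
  simpa using h

theorem inner_nabla_frame_skew {ι : Type*} [Fintype ι] {e : ι → Π y : M, TangentSpace I y}
    {Z : Π y : M, TangentSpace I y} {x : M} (he : ∀ i, SmoothFieldNear (e i) x)
    (hb : ∀ᶠ y in 𝓝 x, ∃ b : OrthonormalBasis ι ℝ (TangentSpace I y), ∀ i, b i = e i y)
    (hZ : MDiffAt (T% Z) x) (i j : ι) :
    (inner ℝ (nabla I Z (e i) x) (e j x) : ℝ) = - inner ℝ (nabla I Z (e j) x) (e i x) := by
  classical
  have h := mvfderiv_inner hZ (he i).mdifferentiableAt (he j).mdifferentiableAt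
  have h1 : (fun y ↦ (inner ℝ (e i y) (e j y) : ℝ)) =ᶠ[𝓝 x] fun _ ↦ if i = j then 1 else 0 := by
    filter_upwards [hb] with y ⟨b, hb⟩
    rw [← hb, ← hb]
    exact orthonormal_iff_ite.1 b.orthonormal i j
  rw [mvfderiv_congr h1, mvfderiv_const, zero_apply] at h
  rw [real_inner_comm (e i x)]
  linarith

theorem sum_mul_eq_zero_of_symm_of_skew {ι : Type*} [Fintype ι] {a w : ι → ι → ℝ}
    (ha : ∀ i j, a i j = a j i) (hw : ∀ i j, w i j = - w j i) : ∑ i, ∑ j, a i j * w i j = 0 := by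
  have h : ∑ i, ∑ j, a i j * w i j = - ∑ i, ∑ j, a i j * w i j := by
    conv_lhs => rw [Finset.sum_comm]
    rw [← Finset.sum_neg_distrib]
    refine Finset.sum_congr rfl fun i _ ↦ ?_
    rw [← Finset.sum_neg_distrib]
    refine Finset.sum_congr rfl fun j _ ↦ ?_
    rw [ha, hw]
    ring
  linarith

namespace AlmostContactMetric

variable {S : AlmostContactMetric I M}

theorem IsAlmostCoKahler.ricci_ζ_ζ (hS : S.IsAlmostCoKahler) (x : M) :
    ricci I x (S.ζ x) (S.ζ x)
      = - ∑ i, (inner ℝ (S.covDerivζ x (frame I x i)) (S.covDerivζ x (frame I x i)) : ℝ) := by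
  obtain ⟨e, he, hex, hb⟩ := exists_orthonormal_frame (I := I) x
  have hζ := S.smoothFieldNear_ζ x
  have hAe : ∀ i, nabla I (e i) S.ζ x = S.covDerivζ x (e i x) :=
    fun i ↦ S.nabla_ζ (he i).mdifferentiableAt
  have hterm : ∀ i, (inner ℝ (curvature I (e i) S.ζ S.ζ x) (e i x) : ℝ) =
      - mvfderiv I (fun y ↦ (inner ℝ (nabla I (e i) S.ζ y) (e i y) : ℝ)) x (S.ζ x)
      - inner ℝ (S.covDerivζ x (e i x)) (S.covDerivζ x (e i x))
      + 2 * inner ℝ (S.covDerivζ x (e i x)) (nabla I S.ζ (e i) x) := by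
    intro i
    have h0 : nabla I (e i) (nabla I S.ζ S.ζ) x = 0 := by
      rw [nabla_congr_right (e i) (Y' := 0), nabla_zero_right (he i).mdifferentiableAt]
      refine Filter.Eventually.of_forall fun y ↦ ?_
      rw [S.nabla_ζ (S.smoothFieldNear_ζ y).mdifferentiableAt, hS.covDerivζ_ζ]
      rfl
    have h1 := mvfderiv_inner hζ.mdifferentiableAt ((he i).nabla hζ).mdifferentiableAt
      (he i).mdifferentiableAt
    rw [h1, curvature, h0, zero_sub, inner_sub_left, inner_neg_left,
      S.nabla_ζ ((he i).mlieBracket hζ).mdifferentiableAt, hS.inner_covDerivζ_comm,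
      ← nabla_sub_nabla (he i).mdifferentiableAt hζ.mdifferentiableAt, inner_sub_left, hAe,
      real_inner_comm (nabla I S.ζ (e i) x)]
    ring
  have htr : ∑ i, mvfderiv I (fun y ↦ (inner ℝ (nabla I (e i) S.ζ y) (e i y) : ℝ)) x (S.ζ x)
      = 0 := by
    rw [← mvfderiv_sum Finset.univ fun i _ ↦ SmoothFnNear.inner ((he i).nabla hζ) (he i)]
    have h0 : (fun y ↦ ∑ i, (inner ℝ (nabla I (e i) S.ζ y) (e i y) : ℝ)) =ᶠ[𝓝 x] fun _ ↦ 0 := by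
      have he' := Filter.eventually_all.2 fun i ↦ (he i).eventually
      filter_upwards [hb, he'] with y ⟨b, hb⟩ hy
      rw [← hS.sum_inner_covDerivζ b]
      refine Finset.sum_congr rfl fun i _ ↦ ?_
      rw [S.nabla_ζ (hy i).mdifferentiableAt, hb]
    rw [mvfderiv_congr h0, mvfderiv_const, zero_apply]
  have hskew : ∑ i, (inner ℝ (S.covDerivζ x (e i x)) (nabla I S.ζ (e i) x) : ℝ) = 0 := by
    obtain ⟨b, hb'⟩ := hb.self_of_nhds
    rw [← sum_mul_eq_zero_of_symm_of_skew
      (a := fun i j ↦ (inner ℝ (S.covDerivζ x (e i x)) (e j x) : ℝ))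
      (w := fun i j ↦ (inner ℝ (nabla I S.ζ (e i) x) (e j x) : ℝ))
      (fun i j ↦ by rw [hS.inner_covDerivζ_comm, real_inner_comm])
      (inner_nabla_frame_skew he hb hζ.mdifferentiableAt)]
    refine Finset.sum_congr rfl fun i _ ↦ ?_
    rw [← b.sum_inner_mul_inner]
    refine Finset.sum_congr rfl fun j _ ↦ ?_
    rw [hb', real_inner_comm (e j x), real_inner_comm (e j x) (nabla I S.ζ (e i) x)]
  rw [ricci_eq_sum hζ hζ he hex, Finset.sum_congr rfl fun i _ ↦ hterm i,
    Finset.sum_add_distrib, Finset.sum_sub_distrib, Finset.sum_neg_distrib, htr, ← Finset.mul_sum,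
    hskew]
  simp only [hex]
  ring

theorem sum_η_sq {x : M} {ι : Type*} [Fintype ι]
    (b : OrthonormalBasis ι ℝ (TangentSpace I x)) : ∑ i, S.η x (b i) * S.η x (b i) = 1 := by
  rw [← S.inner_ζ_ζ x, ← b.sum_inner_mul_inner]
  refine Finset.sum_congr rfl fun i _ ↦ ?_
  rw [η_eq_inner, real_inner_comm (S.ζ x)]

/-- On an `η`-Einstein manifold the scalar curvature is constant. -/
theorem IsEtaEinstein.scalarCurvature_eq {a b : ℝ} (h : S.IsEtaEinstein a b) (x : M) :
    scalarCurvature I x = a * Module.finrank ℝ E + b := by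
  have h1 : ∀ i, ricci I x (frame I x i) (frame I x i)
      = a + b * (S.η x (frame I x i) * S.η x (frame I x i)) := by
    intro i
    rw [h, real_inner_self_eq_norm_sq, (frame I x).norm_eq_one]
    ring
  rw [scalarCurvature, Finset.sum_congr rfl fun i _ ↦ h1 i, Finset.sum_add_distrib,
    ← Finset.mul_sum, sum_η_sq]
  simp [mul_comm]
  left
  rfl

end AlmostContactMetric
end Ricci

section QuasiEinstein

variable {E : Type*} [NormedAddCommGroup E] [NormedSpace ℝ E] [FiniteDimensional ℝ E]
  {H : Type*} [TopologicalSpace H] {I : ModelWithCorners ℝ E H}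
  {M : Type*} [TopologicalSpace M] [ChartedSpace H M] [IsManifold I ∞ M]
  [RiemannianBundle (fun x : M ↦ TangentSpace I x)]
  [IsContMDiffRiemannianBundle I ∞ E (fun x : M ↦ TangentSpace I x)]

namespace AlmostContactMetric

variable {S : AlmostContactMetric I M}

/-- The equation `Hess f = μ g - b η ⊗ η + c df ⊗ df` with constant coefficients, for a smooth
function `f`. -/
structure HessianEquation (S : AlmostContactMetric I M) (f : M → ℝ) (μ b c : ℝ) : Prop where
  smooth : ContMDiff I 𝓘(ℝ, ℝ) ∞ f
  hess_eq : ∀ (x : M) (u v : TangentSpace I x), hess I f x u v =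
    μ * inner ℝ u v - b * (S.η x u * S.η x v) + c * (mvfderiv I f x u * mvfderiv I f x v)

namespace HessianEquation

variable {f : M → ℝ} {μ b c : ℝ}

theorem smoothFnNear (h : S.HessianEquation f μ b c) (x : M) : SmoothFnNear I f x :=
  Filter.Eventually.of_forall h.smooth

theorem smoothFieldNear_grad (h : S.HessianEquation f μ b c) (x : M) :
    SmoothFieldNear (grad I f) x := SmoothFieldNear.grad (h.smoothFnNear x)

theorem nabla_grad (h : S.HessianEquation f μ b c) {X : Π x : M, TangentSpace I x} {x : M}
    (hX : MDiffAt (T% X) x) :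
    nabla I X (grad I f) x = μ • X x + (-b * S.η x (X x)) • S.ζ x
      + (c * mvfderiv I f x (X x)) • grad I f x := by
  rw [nabla_congr_left hX (mdifferentiableAt_ext (X x))
    (h.smoothFieldNear_grad x).mdifferentiableAt (ext_self _).symm]
  refine ext_inner_right ℝ fun w ↦ ?_
  have := h.hess_eq x (X x) w
  rw [hess] at this
  rw [this, inner_add_left, inner_add_left, inner_smul_left, inner_smul_left, inner_smul_left,
    inner_grad, real_inner_comm w (S.ζ x), ← S.η_eq_inner]
  simp only [conj_trivial]
  ring

theorem curvature_grad (hS : S.IsAlmostCoKahler) (h : S.HessianEquation f μ b c)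
    {X Y : Π x : M, TangentSpace I x} {x : M} (hX : SmoothFieldNear X x)
    (hY : SmoothFieldNear Y x) :
    curvature I X Y (grad I f) x =
      -b • (S.η x (Y x) • S.covDerivζ x (X x) - S.η x (X x) • S.covDerivζ x (Y x))
      + c • (mvfderiv I f x (Y x) • nabla I X (grad I f) x
        - mvfderiv I f x (X x) • nabla I Y (grad I f) x) := by
  have hζ := S.smoothFieldNear_ζ x
  have hf := h.smoothFnNear x
  have hD := h.smoothFieldNear_grad x
  have key : ∀ {U V : Π x : M, TangentSpace I x}, SmoothFieldNear U x → SmoothFieldNear V x →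
      nabla I U (nabla I V (grad I f)) x = μ • nabla I U V x
        + ((-b * mvfderiv I (fun y ↦ S.η y (V y)) x (U x)) • S.ζ x
          + (-b * S.η x (V x)) • S.covDerivζ x (U x))
        + ((c * mvfderiv I (fun y ↦ mvfderiv I f y (V y)) x (U x)) • grad I f x
          + (c * mvfderiv I f x (V x)) • nabla I U (grad I f) x) := by
    intro U V hU hV
    have hη : SmoothFnNear I (fun y ↦ S.η y (V y)) x := by
      simp only [S.η_eq_inner]
      exact SmoothFnNear.inner hV hζ
    have hη' := hη.const_mul (-b)
    have hfV := SmoothFnNear.mvfderiv hf hV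
    have hfV' := hfV.const_mul c
    have h1 : ∀ᶠ y in 𝓝 x, nabla I V (grad I f) y = (((fun _ : M ↦ μ) • V
        + (fun y ↦ -b * S.η y (V y)) • S.ζ)
        + (fun y ↦ c * mvfderiv I f y (V y)) • grad I f : Π y : M, TangentSpace I y) y := by
      filter_upwards [hV.eventually] with y hy
      exact h.nabla_grad hy.mdifferentiableAt
    have hμ : SmoothFnNear I (fun _ : M ↦ μ) x :=
      Filter.Eventually.of_forall fun y ↦ contMDiffAt_const
    have s1 := SmoothFieldNear.smul hμ hV
    have s2 := SmoothFieldNear.smul hη' hζ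
    have s3 := SmoothFieldNear.smul hfV' hD
    rw [nabla_congr_right U h1, nabla_add_right hU.mdifferentiableAt (s1.add s2).mdifferentiableAt
      s3.mdifferentiableAt, nabla_add_right hU.mdifferentiableAt s1.mdifferentiableAt
      s2.mdifferentiableAt,
      nabla_smul_right hU.mdifferentiableAt hV.mdifferentiableAt hμ.mdifferentiableAt,
      nabla_smul_right hU.mdifferentiableAt hζ.mdifferentiableAt hη'.mdifferentiableAt,
      nabla_smul_right hU.mdifferentiableAt hD.mdifferentiableAt hfV'.mdifferentiableAt,
      mvfderiv_const_mul _ hη.mdifferentiableAt, mvfderiv_const_mul _ hfV.mdifferentiableAt,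
      mvfderiv_const, S.nabla_ζ hU.mdifferentiableAt]
    simp
  have hdη := hS.1 x X Y hX.at hY.at
  simp only [extDeriv₁] at hdη
  have e1 : S.η x (mlieBracket I X Y x) = mvfderiv I (fun y ↦ S.η y (Y y)) x (X x)
      - mvfderiv I (fun y ↦ S.η y (X y)) x (Y x) := by linarith
  rw [curvature, key hX hY, key hY hX, h.nabla_grad (hX.mlieBracket hY).mdifferentiableAt, e1,
    mvfderiv_mlieBracket hX hY hf, ← nabla_sub_nabla hX.mdifferentiableAt hY.mdifferentiableAt]
  module

theorem inner_nabla_grad (h : S.HessianEquation f μ b c) {X : Π x : M, TangentSpace I x} {x : M}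
    (hX : MDiffAt (T% X) x) (v : TangentSpace I x) :
    (inner ℝ (nabla I X (grad I f) x) v : ℝ) = μ * inner ℝ (X x) v
      - b * (S.η x (X x) * S.η x v) + c * (mvfderiv I f x (X x) * mvfderiv I f x v) := by
  rw [h.nabla_grad hX, inner_add_left, inner_add_left, inner_smul_left, inner_smul_left,
    inner_smul_left, inner_grad, real_inner_comm v (S.ζ x), ← S.η_eq_inner]
  simp only [conj_trivial]
  ring

theorem ricci_grad (hS : S.IsAlmostCoKahler) (h : S.HessianEquation f μ b c) (x : M)
    (u : TangentSpace I x) :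
    ricci I x u (grad I f x) = c * (((Module.finrank ℝ E - 1) * μ - b) * mvfderiv I f x u
      + b * (S.η x u * mvfderiv I f x (S.ζ x))) := by
  obtain ⟨e, he, hex, -⟩ := exists_orthonormal_frame (I := I) x
  have hu := smoothFieldNear_ext u
  have hux := ext_self (I := I) u
  have hterm : ∀ i, (inner ℝ (curvature I (e i) (ext I u) (grad I f) x) (e i x) : ℝ) =
      -b * S.η x u * inner ℝ (S.covDerivζ x (frame I x i)) (frame I x i)
      + b * (inner ℝ (S.covDerivζ x u) (frame I x i) * inner ℝ (frame I x i) (S.ζ x))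
      + c * (mvfderiv I f x u * (μ - b * (S.η x (frame I x i) * S.η x (frame I x i))))
      - c * (μ * (inner ℝ u (frame I x i) * inner ℝ (frame I x i) (grad I f x))
        - b * S.η x u * (inner ℝ (S.ζ x) (frame I x i) * inner ℝ (frame I x i) (grad I f x))) := by
    intro i
    have hd : mvfderiv I f x (frame I x i) = inner ℝ (frame I x i) (grad I f x) := by
      rw [← inner_grad, real_inner_comm]
    have h1 : (inner ℝ (frame I x i) (frame I x i) : ℝ) = 1 := by
      rw [real_inner_self_eq_norm_sq, (frame I x).norm_eq_one]
      norm_num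
    rw [h.curvature_grad hS (he i) hu]
    simp only [inner_add_left, inner_sub_left, inner_smul_left, conj_trivial,
      h.inner_nabla_grad (he i).mdifferentiableAt, h.inner_nabla_grad hu.mdifferentiableAt, hex,
      hux, h1, hd]
    rw [S.η_eq_inner x (frame I x i), real_inner_comm (frame I x i) (S.ζ x)]
    ring
  have h2 := ricci_eq_sum hu (h.smoothFieldNear_grad x) he hex
  rw [hux] at h2
  rw [h2, Finset.sum_congr rfl fun i _ ↦ hterm i]
  simp only [Finset.sum_add_distrib, Finset.sum_sub_distrib, ← Finset.mul_sum,
    OrthonormalBasis.sum_inner_mul_inner, hS.sum_inner_covDerivζ, sum_η_sq, inner_covDerivζ_ζ]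
  have h3 : (inner ℝ u (grad I f x) : ℝ) = mvfderiv I f x u := by
    rw [real_inner_comm, inner_grad]
  have h4 : (inner ℝ (S.ζ x) (grad I f x) : ℝ) = mvfderiv I f x (S.ζ x) := by
    rw [real_inner_comm, inner_grad]
  have h5 : (Module.finrank ℝ (TangentSpace I x) : ℝ) = Module.finrank ℝ E := rfl
  rw [h3, h4]
  simp only [Finset.sum_const, Finset.card_univ, Fintype.card_fin, nsmul_eq_mul, h5]
  ring

end HessianEquation

theorem IsAlmostCoKahler.covDerivζ_eq_zero_of_point (hS : S.IsAlmostCoKahler) {a b : ℝ}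
    (hRic : S.IsEtaEinstein a b) {y : M} (hy : ∀ u, S.covDerivζ y u = 0) (x : M)
    (u : TangentSpace I x) : S.covDerivζ x u = 0 := by
  have h1 : ∀ z : M, a + b = ricci I z (S.ζ z) (S.ζ z) := fun z ↦ by
    rw [hRic, S.inner_ζ_ζ, S.η_ζ]
    ring
  have h2 := (h1 x).symm.trans (h1 y)
  rw [hS.ricci_ζ_ζ, hS.ricci_ζ_ζ] at h2
  simp only [hy, inner_zero_left, Finset.sum_const_zero, neg_zero] at h2
  rw [neg_eq_zero, Finset.sum_eq_zero_iff_of_nonneg fun i _ ↦ real_inner_self_nonneg] at h2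
  have h3 : (S.covDerivζ x).toLinearMap = 0 := by
    refine (frame I x).toBasis.ext fun i ↦ ?_
    rw [OrthonormalBasis.coe_toBasis]
    exact inner_self_eq_zero.1 (h2 i (Finset.mem_univ i))
  exact congrArg (fun L ↦ L u) h3

theorem η_sub_smul_ζ (x : M) (u : TangentSpace I x) : S.η x (u - S.η x u • S.ζ x) = 0 := by
  rw [map_sub, map_smul, S.η_ζ]
  simp

namespace HessianEquation

variable {f : M → ℝ} {μ a b c : ℝ}

theorem exists_mvfderiv_ne_zero (h : S.HessianEquation f μ b c) (hb : b ≠ 0) {x : M}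
    {w : TangentSpace I x} (hw : S.η x w = 0) (hw0 : w ≠ 0) :
    ∃ (y : M) (v : TangentSpace I y), mvfderiv I f y v ≠ 0 := by
  by_contra! hall
  have hg : grad I f = (0 : Π x : M, TangentSpace I x) := by
    funext y
    refine ext_inner_right ℝ fun v ↦ ?_
    rw [inner_grad, hall]
    simp
  have h1 : ∀ u : TangentSpace I x,
      μ * inner ℝ u u - b * (S.η x u * S.η x u) = 0 := by
    intro u
    have := h.inner_nabla_grad (mdifferentiableAt_ext u) u
    rw [hg, nabla_zero_right (mdifferentiableAt_ext u), inner_zero_left, hall, ext_self] at this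
    linarith
  have h2 := h1 (S.ζ x)
  have h3 := h1 w
  rw [S.inner_ζ_ζ, S.η_ζ] at h2
  rw [hw, mul_zero, mul_zero, sub_zero] at h3
  have h4 : μ = 0 := (mul_eq_zero.1 h3).resolve_right fun h ↦ hw0 (inner_self_eq_zero.1 h)
  exact hb (by linarith)

theorem einstein_grad (hS : S.IsAlmostCoKahler) (hRic : S.IsEtaEinstein a b)
    (h : S.HessianEquation f μ b c) (x : M) (u : TangentSpace I x) :
    a * mvfderiv I f x u + b * (S.η x u * mvfderiv I f x (S.ζ x))
      = c * (((Module.finrank ℝ E - 1) * μ - b) * mvfderiv I f x u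
      + b * (S.η x u * mvfderiv I f x (S.ζ x))) := by
  rw [← h.ricci_grad hS, hRic, real_inner_comm, inner_grad, S.η_eq_inner x (grad I f x), inner_grad]

/-- If `df` vanishes on the kernel of `η`, then `∇ζ` vanishes wherever `df` does not. -/
theorem covDerivζ_eq_zero_of_ker (hS : S.IsAlmostCoKahler) (h : S.HessianEquation f μ b c)
    (hker : ∀ (x : M) (u : TangentSpace I x), S.η x u = 0 → mvfderiv I f x u = 0) {x : M}
    (hx : mvfderiv I f x (S.ζ x) ≠ 0) (u : TangentSpace I x) : S.covDerivζ x u = 0 := by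
  have hζ := S.smoothFieldNear_ζ x
  have hgζ : SmoothFnNear I (fun y ↦ mvfderiv I f y (S.ζ y)) x :=
    SmoothFnNear.mvfderiv (h.smoothFnNear x) hζ
  have hgrad : grad I f = (fun y ↦ mvfderiv I f y (S.ζ y)) • S.ζ := by
    funext y
    refine ext_inner_right ℝ fun v ↦ ?_
    have h1 := hker y _ (S.η_sub_smul_ζ y v)
    rw [map_sub, map_smul, sub_eq_zero] at h1
    rw [inner_grad, Pi.smul_apply', inner_smul_left, real_inner_comm, ← S.η_eq_inner, h1]
    simp [mul_comm]
  have hA : ∀ v w : TangentSpace I x, S.η x v = 0 → S.η x w = 0 →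
      mvfderiv I f x (S.ζ x) * inner ℝ (S.covDerivζ x v) w = μ * inner ℝ v w := by
    intro v w hv hw
    have hv' := mdifferentiableAt_ext v
    have h1 := h.inner_nabla_grad hv' w
    rw [hgrad, nabla_smul_right hv' hζ.mdifferentiableAt hgζ.mdifferentiableAt, S.nabla_ζ hv',
      ext_self, inner_add_left, inner_smul_left, inner_smul_left, real_inner_comm w (S.ζ x),
      ← S.η_eq_inner, hv, hw, hker x v hv] at h1
    simpa using h1
  have hker0 : ∀ v : TangentSpace I x, S.η x v = 0 → S.covDerivζ x v = 0 := by
    intro v hv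
    by_cases hv0 : v = 0
    · rw [hv0, map_zero]
    have h1 := hA v v hv hv
    have h2 := hA _ _ (S.η_φ x v) (S.η_φ x v)
    have h3 := S.compat x v v
    have h4 := S.compat x (S.covDerivζ x v) v
    rw [hv, mul_zero, add_zero] at h3 h4
    rw [← h3, hS.covDerivζ_φ, inner_neg_left, ← h4] at h2
    have h5 : μ * (inner ℝ v v : ℝ) = 0 := by linarith
    have h6 : μ = 0 := (mul_eq_zero.1 h5).resolve_right fun h ↦ hv0 (inner_self_eq_zero.1 h)
    have h7 := hA v (S.covDerivζ x v) hv (by rw [S.η_eq_inner, S.inner_covDerivζ_ζ])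
    rw [h6, zero_mul] at h7
    exact inner_self_eq_zero.1 ((mul_eq_zero.1 h7).resolve_left hx)
  have h1 := hker0 _ (S.η_sub_smul_ζ x u)
  rwa [map_sub, map_smul, hS.covDerivζ_ζ, smul_zero, sub_zero] at h1

theorem eq_of_mvfderiv_ζ_eq_zero (hS : S.IsAlmostCoKahler) (h : S.HessianEquation f μ b c)
    (h0 : ∀ x : M, mvfderiv I f x (S.ζ x) = 0) (x : M) : μ = b := by
  have hζ := (S.smoothFieldNear_ζ x).mdifferentiableAt
  have h1 := mvfderiv_inner hζ (h.smoothFieldNear_grad x).mdifferentiableAt hζ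
  simp only [inner_grad, h0, mvfderiv_const, zero_apply] at h1
  rw [h.inner_nabla_grad hζ, S.nabla_ζ hζ, hS.covDerivζ_ζ, map_zero, h0, S.inner_ζ_ζ,
    S.η_ζ] at h1
  linarith

/-- The field `ζ` is parallel on an `η`-Einstein almost co-Kähler manifold carrying a solution of
the quasi-Einstein equation with generic constants. -/
theorem covDerivζ_eq_zero (hS : S.IsAlmostCoKahler) (hRic : S.IsEtaEinstein a b) (hb : b ≠ 0)
    (h : S.HessianEquation f μ b c) (hc : c ≠ 1) (hne : a ≠ (Module.finrank ℝ E - 2) * b * c)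
    (x : M) (u : TangentSpace I x) : S.covDerivζ x u = 0 := by
  by_contra hu
  obtain ⟨y, v, hv⟩ := h.exists_mvfderiv_ne_zero hb (S.η_sub_smul_ζ x u) (fun h0 ↦ hu (by
    rw [sub_eq_zero.1 h0, map_smul, hS.covDerivζ_ζ, smul_zero]))
  by_cases hc2 : a - c * ((Module.finrank ℝ E - 1) * μ - b) = 0
  · have h0 : ∀ z : M, mvfderiv I f z (S.ζ z) = 0 := by
      intro z
      have h1 := h.einstein_grad hS hRic z (S.ζ z)
      rw [S.η_ζ] at h1
      have h2 : b * (1 - c) * mvfderiv I f z (S.ζ z) = 0 := by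
        linear_combination h1 - mvfderiv I f z (S.ζ z) * hc2
      exact (mul_eq_zero.1 h2).resolve_left (mul_ne_zero hb (sub_ne_zero.2 hc.symm))
    have hμ := h.eq_of_mvfderiv_ζ_eq_zero hS h0 x
    rw [hμ] at hc2
    exact hne (by linear_combination hc2)
  · have hker : ∀ (z : M) (w : TangentSpace I z), S.η z w = 0 → mvfderiv I f z w = 0 := by
      intro z w hw
      have h1 := h.einstein_grad hS hRic z w
      rw [hw] at h1
      have h2 : (a - c * ((Module.finrank ℝ E - 1) * μ - b)) * mvfderiv I f z w = 0 := by
        linear_combination h1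
      exact (mul_eq_zero.1 h2).resolve_left hc2
    have hy : mvfderiv I f y (S.ζ y) ≠ 0 := by
      intro h0
      have h1 := hker y _ (S.η_sub_smul_ζ y v)
      rw [map_sub, map_smul, h0, smul_zero, sub_zero] at h1
      exact hv h1
    exact hu (hS.covDerivζ_eq_zero_of_point hRic (h.covDerivζ_eq_zero_of_ker hS hker hy) x u)

end HessianEquation

theorem isKilling_of_covDerivζ_eq_zero
    (h : ∀ (x : M) (u : TangentSpace I x), S.covDerivζ x u = 0) : IsKilling I S.ζ := by
  intro x X Y hX hY
  have hX' := hX.mdifferentiableAt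
  have hY' := hY.mdifferentiableAt
  have hζ := (S.smoothFieldNear_ζ x).mdifferentiableAt
  rw [lieMetric, mvfderiv_inner hζ hX' hY', ← nabla_sub_nabla hζ hX', ← nabla_sub_nabla hζ hY',
    S.nabla_ζ hX', S.nabla_ζ hY', h, h]
  simp

/-- The defining equation of an `(m, ρ)`-quasi-Einstein soliton on an `η`-Einstein manifold. -/
theorem IsEtaEinstein.exists_hessianEquation {a b : ℝ} (hRic : S.IsEtaEinstein a b) {m : ℝ≥0∞}
    {ρ : ℝ} (hqE : IsQuasiEinstein I M m ρ) :
    ∃ (f : M → ℝ) (μ : ℝ), S.HessianEquation f μ b (m⁻¹).toReal := by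
  obtain ⟨-, f, lam, hf, heq⟩ := hqE
  refine ⟨f, ρ * (a * Module.finrank ℝ E + b) + lam - a, hf, fun x u v ↦ ?_⟩
  have h1 := heq x u v
  rw [hRic.scalarCurvature_eq, hRic] at h1
  linear_combination h1

end AlmostContactMetric
end QuasiEinstein
end Riem

theorem theorem4 (n : ℕ) {M : Type*} [TopologicalSpace M] [T2Space M] [SecondCountableTopology M]
    [ChartedSpace (EuclideanSpace ℝ (Fin (2 * n + 1))) M] [IsManifold (𝓡 (2 * n + 1)) ∞ M]
    [RiemannianBundle (fun x : M ↦ TangentSpace (𝓡 (2 * n + 1)) x)]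
    [IsContMDiffRiemannianBundle (𝓡 (2 * n + 1)) ∞ (EuclideanSpace ℝ (Fin (2 * n + 1)))
      (fun x : M ↦ TangentSpace (𝓡 (2 * n + 1)) x)]
    (S : Riem.AlmostContactMetric (𝓡 (2 * n + 1)) M) (hS : S.IsAlmostCoKahler)
    (a₁ b₁ : ℝ) (hb₁ : b₁ ≠ 0) (hRic : S.IsEtaEinstein a₁ b₁)
    (m : ℝ≥0∞) (ρ : ℝ) (hqE : Riem.IsQuasiEinstein (𝓡 (2 * n + 1)) M m ρ) (hm : m ≠ 1)
    (hne : a₁ ≠ (2 * (n : ℝ) - 1) * b₁ * (m⁻¹).toReal) :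
    (∀ (x : M) (u : TangentSpace (𝓡 (2 * n + 1)) x), S.h x u = 0) ∧
      Riem.IsKilling (𝓡 (2 * n + 1)) S.ζ ∧ S.IsKAlmostCoKahler := by
  obtain ⟨f, μ, h⟩ := hRic.exists_hessianEquation hqE
  have hc : (m⁻¹).toReal ≠ 1 := by
    rw [Ne, ENNReal.toReal_eq_one_iff, ENNReal.inv_eq_one]
    exact hm
  have hA := h.covDerivζ_eq_zero hS hRic hb₁ hc (by
    rw [finrank_euclideanSpace_fin]
    intro h0
    apply hne
    rw [h0]
    push_cast
    ring)
  have hK := Riem.AlmostContactMetric.isKilling_of_covDerivζ_eq_zero hA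
  refine ⟨fun x u ↦ ?_, hK, hS, hK⟩
  rw [hS.h_eq, hA, neg_zero]
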